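/- Let $\gamma$ be the Euler–Mascheroni constant and let $\mathrm{Ei}(x)=\ln|x|+\gamma+\int_0^x\frac{e^t-1}{t}\,dt$ for real $x\neq 0$ be the exponential integral; for complex $z\ne0$ put $\mathrm{Ei}(z)=\operatorname{Log} z+\gamma+\int_0^z\frac{e^t-1}{t}\,dt$ with the principal logarithm (the choice of branch does not affect $e^{-n\,\mathrm{Ei}(z)}$ for integers $n$). For $n\ge 1$ let $$a_n=\frac1n\operatorname*{res}_{z=0} e^{-n(\mathrm{Ei}(z)-\gamma)}\,dz .$$ Then: 1. Each $a_n$ is real, and $a_n=\frac1n\operatorname*{res}_{z=0}\exp\left(-n\int_0^z\frac{e^t-1}{t}\,dt\right)\frac{dz}{z^n}$. 2. The power series $\sum_{n\ge1}a_nz^n$ has a positive radius of convergence and is the Taylor series at $0$ of the local inverse $\psi$ at $0$ of the function $z\mapsto z\exp\left(\int_0^z\frac{e^t-1}{t}\,dt\right)$. 3. There is a unique real $\mu>0$ with $\mathrm{Ei}(\ln\mu)=0$ (the Ramanujan–Soldner constant). 4. With this $\mu$, where every series is understood as the limit of its partial sums, $$\sum_{n=1}^\infty\frac{a_n}{n}e^{-\gamma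 n}=\mu-1,\qquad \sum_{n=1}^\infty\frac{(-1)^{n-1}a_n}{n}e^{-\gamma n}=1,\qquad \sum_{n=1}^\infty\frac{(-1)^{n-1}a_n}{n^2}e^{-\gamma n}=\ln 2,$$ and in particular these three series converge. 5. The partial sums of $\sum_{n=1}^\infty(-1)^{n-1}a_ne^{-\gamma n}$ tend to $+\infty$. 6. If the series $\sum_{n=1}^\infty a_ne^{-\gamma n}$ converges, then its sum is $\ln\mu$. -/

import Mathlib

open Filter Topology

namespace RamanujanSoldner

noncomputable section

/-- The residue of `f` at `c`: the limit, as `r` decreases to `0`, of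
`(2 π i)⁻¹ ∮_{|z - c| = r} f(z) dz`. When `f` is holomorphic on a punctured neighbourhood of `c`, this
expression does not depend on small `r`, and is the coefficient of `(z - c)⁻¹` in the
Laurent expansion. -/
def residue (f : ℂ → ℂ) (c : ℂ) : ℂ :=
  limUnder (𝓝[>] (0 : ℝ)) fun r : ℝ =>
    (2 * (Real.pi : ℂ) * Complex.I)⁻¹ * ∮ z in C(c, r), f z

/-- The entire function `∫₀ᶻ (eᵗ - 1)/t dt`, integrated along the segment `t = s z`,
`0 ≤ s ≤ 1`. -/
def ein (z : ℂ) : ℂ :=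
  ∫ s in (0 : ℝ)..1, (Complex.exp (s * z) - 1) / (s * z) * z

/-- The exponential integral at a complex argument (principal branch of the logarithm):
`Ei z = log z + γ + ∫₀ᶻ (eᵗ - 1)/t dt`. -/
def cEi (z : ℂ) : ℂ :=
  Complex.log z + (Real.eulerMascheroniConstant : ℂ) + ein z

/-- The exponential integral at a nonzero real argument:
`Ei x = ln |x| + γ + ∫₀ˣ (eᵗ - 1)/t dt`. -/
def Ei (x : ℝ) : ℝ :=
  Real.log |x| + Real.eulerMascheroniConstant + ∫ t in (0 : ℝ)..x, (Real.exp t - 1) / t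

/-- The function `T(z) = z exp (∫₀ᶻ (eᵗ - 1)/t dt)`, whose local inverse at `0` is `ψ`. -/
def T (z : ℂ) : ℂ :=
  z * Complex.exp (ein z)

/-- `(1/n) res_{z=0} e^{-n (Ei z - γ)} dz`, as a complex number. -/
def aComplex (n : ℕ) : ℂ :=
  1 / (n : ℂ) *
    residue (fun z => Complex.exp (-(n : ℂ) * (cEi z - (Real.eulerMascheroniConstant : ℂ)))) 0

/-- The real sequence `aₙ`: the real part of `aComplex n` (that `aComplex n` is real is
part of the theorem). -/
def a (n : ℕ) : ℝ :=
  (aComplex n).re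

/-- The partial sum `∑_{n=1}^N u n` of a series indexed from `1`. -/
def partialSum (u : ℕ → ℝ) (N : ℕ) : ℝ :=
  ∑ n ∈ Finset.Icc 1 N, u n

/-- The series `∑_{n=1}^∞ u n` converges to `L`, as a limit of partial sums. -/
def SeriesTo (u : ℕ → ℝ) (L : ℝ) : Prop :=
  Tendsto (partialSum u) atTop (𝓝 L)

end

end RamanujanSoldner

namespace RamanujanSoldner

/-! Put ρ = e^{-γ} and U = Re Ei, so that |T| = ρ e^U. On the real line T increases strictly, from
the limit -ρ at -∞ (because U → 0 there) through 0 to the value ρ at l = ln μ. The crux is the bound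
aₙ ρⁿ = O(1/n), `exists_abs_a_le`.

For this bound T⁻ⁿ is integrated around a rectangle with sides Re z = -X, Re z = 1 and Im z = ±3π/4,
where X e^X = n. On the right side U ≥ 0; on the left side U ≥ -1/n; on the horizontal sides nU
grows at least linearly in the distance from the left side. Hence the integral is O(e^{γn}). By
Lagrange inversion (`mul_coeff_eq_resT`) and the identity theorem, ∑ aₙ wⁿ inverts T on the whole
disc |w| < ρ, so ∑ aₙ T(x)ⁿ = x for real x < l (`tsum_a_reT`).

With w = T(x) one has dw/w = (eˣ/x) dx, so dividing the coefficients by n means multiplying the sum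
by eˣ/x and integrating from 0. This turns x into eˣ - 1, and that into Ein(2x) - Ein(x). Both new
series converge absolutely on |w| = ρ, and their boundary values are the limits x → l and x → -∞; ln
2 appears because Ein x + ln|x| → -γ at -∞. For the series of the aₙ themselves, Abel's theorem
settles w = ρ, while at w = -ρ the O(1/n) bound keeps partial sums within a constant of Abel means,
which tend to infinity. -/

/-! ### The entire functions `ein` and `T` and their restrictions to the real line. -/

/-- The entire function `(eᶻ - 1) / z`. -/
noncomputable def expSlope : ℂ → ℂ := dslope Complex.exp 0

theorem expSlope_of_ne {z : ℂ} (hz : z ≠ 0) : expSlope z = (Complex.exp z - 1) / z := by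
  simp [expSlope, dslope_of_ne _ hz, slope_def_field]

theorem mul_expSlope (z : ℂ) : z * expSlope z = Complex.exp z - 1 := by
  rcases eq_or_ne z 0 with rfl | hz
  · simp
  · rw [expSlope_of_ne hz]; field_simp

theorem differentiable_expSlope : Differentiable ℂ expSlope := by
  rw [← differentiableOn_univ]
  exact (Complex.differentiableOn_dslope univ_mem).2 Complex.differentiable_exp.differentiableOn

theorem hasDerivAt_ein (z : ℂ) : HasDerivAt ein (expSlope z) z := by
  obtain ⟨G, hG⟩ := differentiable_expSlope.isExactOn_univ
  have key : ein = fun z => G z - G 0 := by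
    funext z
    have h1 : ∀ s ∈ Set.uIcc (0 : ℝ) 1,
        HasDerivAt (fun s : ℝ => G (s * z)) (expSlope (s * z) * z) s := fun s _ => by
      have := (hG ((s : ℂ) * z) trivial).comp (s : ℂ) ((hasDerivAt_id (s : ℂ)).mul_const z)
      simpa using this.comp_ofReal
    have hc : Continuous fun s : ℝ => expSlope (s * z) * z := by
      have := differentiable_expSlope.continuous
      fun_prop
    have h2 := intervalIntegral.integral_eq_sub_of_hasDerivAt h1 (hc.intervalIntegrable 0 1)
    simp only [Complex.ofReal_one, one_mul, Complex.ofReal_zero, zero_mul] at h2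
    rw [← h2, ein]
    refine intervalIntegral.integral_congr_ae (Eventually.of_forall fun s hs => ?_)
    rw [Set.uIoc_of_le zero_le_one] at hs
    rcases eq_or_ne z 0 with rfl | hz
    · simp
    · rw [expSlope_of_ne (mul_ne_zero (by exact_mod_cast hs.1.ne') hz)]
  rw [key]
  exact (hG z trivial).sub_const _

theorem differentiable_ein : Differentiable ℂ ein := fun z => (hasDerivAt_ein z).differentiableAt

@[simp] theorem ein_zero : ein 0 = 0 := by simp [ein]

theorem ein_conj (z : ℂ) : ein (starRingEnd ℂ z) = starRingEnd ℂ (ein z) := by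
  simp only [ein]
  rw [intervalIntegral.integral_of_le zero_le_one, intervalIntegral.integral_of_le zero_le_one,
    ← integral_conj]
  refine MeasureTheory.integral_congr_ae (Eventually.of_forall fun s => ?_)
  simp [← Complex.exp_conj]

/-- The restriction of `ein` to the real line. -/
noncomputable def reEin (x : ℝ) : ℝ := (ein x).re

theorem ein_ofReal (x : ℝ) : ein x = reEin x := by
  have := ein_conj x
  rw [Complex.conj_ofReal] at this
  rw [reEin, Complex.conj_eq_iff_re.1 this.symm]

theorem hasDerivAt_reEin (x : ℝ) : HasDerivAt reEin (expSlope x).re x :=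
  (hasDerivAt_ein x).real_of_complex

theorem expSlope_ofReal_re {x : ℝ} (hx : x ≠ 0) :
    (expSlope x).re = (Real.exp x - 1) / x := by
  rw [expSlope_of_ne (by exact_mod_cast hx)]
  norm_cast

theorem integral_eq_reEin (x : ℝ) : ∫ t in (0 : ℝ)..x, (Real.exp t - 1) / t = reEin x := by
  have hc : Continuous fun x : ℝ => (expSlope x).re :=
    Complex.continuous_re.comp (differentiable_expSlope.continuous.comp Complex.continuous_ofReal)
  have := intervalIntegral.integral_eq_sub_of_hasDerivAt
    (fun t (_ : t ∈ Set.uIcc 0 x) => hasDerivAt_reEin t) (hc.intervalIntegrable 0 x)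
  rw [show reEin 0 = 0 by simp [reEin], sub_zero] at this
  rw [← this]
  refine intervalIntegral.integral_congr_ae ?_
  filter_upwards [MeasureTheory.compl_mem_ae_iff.2 (MeasureTheory.measure_singleton (0 : ℝ))]
    with t ht _
  rw [expSlope_ofReal_re ht]

/-- The product rule produces the factor `1 + z * expSlope z`, which is `exp z`; so the derivative
has no zeros, and is positive on the real line. -/
theorem hasDerivAt_T (z : ℂ) :
    HasDerivAt T (Complex.exp (ein z) * Complex.exp z) z := by
  have := (hasDerivAt_id z).mul (hasDerivAt_ein z).cexp
  convert! this using 1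
  have h := mul_expSlope z
  simp only [id]
  linear_combination -Complex.exp (ein z) * h

theorem differentiable_T : Differentiable ℂ T := fun z => (hasDerivAt_T z).differentiableAt

@[simp] theorem T_zero : T 0 = 0 := by simp [T]

theorem T_ne_zero {z : ℂ} (hz : z ≠ 0) : T z ≠ 0 := mul_ne_zero hz (Complex.exp_ne_zero _)

/-- The restriction of `T` to the real line. -/
noncomputable def reT (x : ℝ) : ℝ := x * Real.exp (reEin x)

theorem T_ofReal (x : ℝ) : T x = reT x := by simp [T, reT, ein_ofReal]

theorem hasDerivAt_reT (x : ℝ) : HasDerivAt reT (Real.exp (reEin x) * Real.exp x) x := by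
  have h := (hasDerivAt_T x).real_of_complex
  have e : (fun x : ℝ => (T x).re) = reT := by funext x; simp [T_ofReal]
  rw [e] at h
  convert! h using 1
  rw [ein_ofReal]; norm_cast

theorem strictMono_reT : StrictMono reT :=
  strictMono_of_hasDerivAt_pos hasDerivAt_reT fun x => by positivity

theorem continuous_reT : Continuous reT :=
  continuous_iff_continuousAt.2 fun x => (hasDerivAt_reT x).continuousAt

@[simp] theorem reT_zero : reT 0 = 0 := by simp [reT]

/-! ### Residues by means of primitives. -/

/-- `R` is the residue of `f` at `0`, in the sense that `f(z) - R/z` has a primitive on `ℂ ∖ {0}`. -/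
def HasResidue (f : ℂ → ℂ) (R : ℝ) : Prop :=
  ∃ P : ℂ → ℂ, ∀ z, z ≠ 0 → HasDerivAt P (f z - R / z) z

/-- Splitting off the value at 0 with `dslope` lowers the pole order by one, and only a simple pole
lacks a primitive. Symmetry under conjugation passes to `dslope`, so every value split off, and
hence `R`, is real. -/
theorem exists_hasResidue_div_pow (n : ℕ) : ∀ H : ℂ → ℂ, Differentiable ℂ H →
    (∀ z, H (starRingEnd ℂ z) = starRingEnd ℂ (H z)) →
    ∃ R, HasResidue (fun z => H z / z ^ n) R := by
  induction n with
  | zero =>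
    intro H hH _
    obtain ⟨P, hP⟩ := hH.isExactOn_univ
    exact ⟨0, P, fun z _ => by simpa using hP z trivial⟩
  | succ n ih =>
    intro H hH hc
    have h1 : Differentiable ℂ (dslope H 0) := by
      rw [← differentiableOn_univ]
      exact (Complex.differentiableOn_dslope univ_mem).2 hH.differentiableOn
    obtain ⟨c, h0⟩ : ∃ c : ℝ, H 0 = c := by
      have := hc 0
      rw [map_zero] at this
      exact ⟨_, (Complex.conj_eq_iff_re.1 this.symm).symm⟩
    have hc1 : ∀ z, dslope H 0 (starRingEnd ℂ z) = starRingEnd ℂ (dslope H 0 z) := by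
      intro z
      rcases eq_or_ne z 0 with rfl | hz
      · have h := (hH 0).hasDerivAt.conj_conj
        have e : starRingEnd ℂ ∘ H ∘ starRingEnd ℂ = H := by
          funext z; simp [hc]
        rw [e] at h
        simp only [map_zero, dslope_same] at h ⊢
        exact h.deriv
      · have hz' : starRingEnd ℂ z ≠ 0 := by simpa using hz
        rw [dslope_of_ne _ hz, dslope_of_ne _ hz', slope_def_field, slope_def_field, hc]
        simp only [map_div₀, map_sub, sub_zero]
        rw [h0, Complex.conj_ofReal]
    obtain ⟨R, P, hP⟩ := ih _ h1 hc1
    have hs : ∀ z, H z = H 0 + z * dslope H 0 z := fun z => by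
      have := sub_smul_dslope H 0 z
      simp only [sub_zero, smul_eq_mul] at this
      rw [this]; ring
    rcases Nat.eq_zero_or_pos n with rfl | hn
    · refine ⟨R + c, P, fun z hz => ?_⟩
      convert! hP z hz using 1
      beta_reduce
      rw [hs z, h0]
      push_cast
      field_simp
      ring
    · refine ⟨R, fun z => P z - H 0 / n * (z ^ n)⁻¹, fun z hz => ?_⟩
      have hd := ((hasDerivAt_pow n z).inv (pow_ne_zero n hz)).const_mul (H 0 / n)
      convert! (hP z hz).sub hd using 1
      beta_reduce
      rw [hs z]
      obtain ⟨m, rfl⟩ : ∃ m, n = m + 1 := ⟨n - 1, by omega⟩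
      have : ((m : ℂ) + 1) ≠ 0 := by exact_mod_cast Nat.succ_ne_zero m
      push_cast
      field_simp
      ring

namespace HasResidue

variable {f : ℂ → ℂ} {R : ℝ}

theorem circleIntegral_eq (h : HasResidue f R) (hf : ContinuousOn f {0}ᶜ) {r : ℝ} (hr : 0 < r) :
    ∮ z in C(0, r), f z = 2 * Real.pi * Complex.I * R := by
  obtain ⟨P, hP⟩ := h
  have hs : Metric.sphere (0 : ℂ) r ⊆ {0}ᶜ := fun z hz h0 => by
    rw [Set.mem_singleton_iff] at h0
    subst h0
    simp at hz
    exact hr.ne' hz.symm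
  have h1 := circleIntegral.integral_eq_zero_of_hasDerivWithinAt (c := 0) hr.le
    fun z hz => (hP z (hs hz)).hasDerivWithinAt
  have i1 : CircleIntegrable f 0 r := (hf.mono hs).circleIntegrable hr.le
  have i2 : CircleIntegrable (fun z => (R : ℂ) / z) 0 r :=
    ContinuousOn.circleIntegrable hr.le (continuousOn_const.div continuousOn_id fun z hz => hs hz)
  rw [circleIntegral.integral_sub i1 i2, sub_eq_zero] at h1
  rw [h1]
  have h2 := circleIntegral.integral_sub_center_inv (0 : ℂ) hr.ne'
  simp only [sub_zero] at h2
  simp only [div_eq_mul_inv]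
  rw [circleIntegral.integral_const_mul, h2]
  ring

theorem residue_eq (h : HasResidue f R) (hf : ContinuousOn f {0}ᶜ) {g : ℂ → ℂ}
    (hg : ∀ z, z ≠ 0 → g z = f z) : residue g 0 = R := by
  refine Tendsto.limUnder_eq (tendsto_const_nhds.congr' ?_)
  filter_upwards [self_mem_nhdsWithin] with r hr
  have : ∮ z in C(0, r), g z = ∮ z in C(0, r), f z := by
    refine circleIntegral.integral_congr (le_of_lt hr) fun z hz => hg z ?_
    rintro rfl
    simp at hz
    exact (ne_of_gt hr) hz.symm
  rw [this, h.circleIntegral_eq hf hr]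
  field_simp [Complex.I_ne_zero, Real.pi_ne_zero]

/-- Three sides lie in the slit plane, where `P + R log z` is a primitive. The left side meets the
cut, so `log (-z)` replaces `log z` there; the mismatch of πi at each left corner adds up to the
right-hand side. -/
theorem rect_integral_eq (h : HasResidue f R) (hf : ContinuousOn f {0}ᶜ) {x₁ x₂ y : ℝ}
    (hx₁ : x₁ < 0) (hx₂ : 0 < x₂) (hy : 0 < y) :
    (∫ x in x₁..x₂, f (x + (-y : ℝ) * Complex.I)) - (∫ x in x₁..x₂, f (x + y * Complex.I))
      + Complex.I * (∫ t in -y..y, f (x₂ + t * Complex.I))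
      - Complex.I * (∫ t in -y..y, f (x₁ + t * Complex.I)) = 2 * Real.pi * Complex.I * R := by
  obtain ⟨P, hP⟩ := h
  have hh : ∀ (F : ℂ → ℂ) (c : ℝ), c ≠ 0 →
      (∀ z, z.im = c → HasDerivAt F (f z) z) →
      ∫ x in x₁..x₂, f (x + c * Complex.I) = F (x₂ + c * Complex.I) - F (x₁ + c * Complex.I) := by
    intro F c hc hF
    have hd : ∀ x ∈ Set.uIcc x₁ x₂,
        HasDerivAt (fun x : ℝ => F (x + c * Complex.I)) (f (x + c * Complex.I)) x := fun x _ => by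
      have := (hF (x + c * Complex.I) (by simp)).comp_add_const (x : ℂ) (c * Complex.I)
      exact this.comp_ofReal
    refine intervalIntegral.integral_eq_sub_of_hasDerivAt hd (Continuous.intervalIntegrable ?_ _ _)
    refine hf.comp_continuous (by fun_prop) fun x h0 => hc ?_
    simpa using congrArg Complex.im h0
  have hv : ∀ (F : ℂ → ℂ) (c : ℝ), c ≠ 0 →
      (∀ z, z.re = c → HasDerivAt F (f z) z) →
      Complex.I * ∫ t in -y..y, f (c + t * Complex.I)
        = F (c + y * Complex.I) - F (c + (-y : ℝ) * Complex.I) := by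
    intro F c hc hF
    have hd : ∀ x ∈ Set.uIcc (-y) y, HasDerivAt (fun x : ℝ => F (c + x * Complex.I))
        (Complex.I * f (c + x * Complex.I)) x := fun x _ => by
      have h1 : HasDerivAt (fun w : ℂ => (c : ℂ) + w * Complex.I) (1 * Complex.I) (x : ℂ) :=
        ((hasDerivAt_id (x : ℂ)).mul_const _).const_add _
      have := (hF (c + x * Complex.I) (by simp)).comp (x : ℂ) h1
      simpa [mul_comm] using this.comp_ofReal
    rw [← intervalIntegral.integral_const_mul]
    refine intervalIntegral.integral_eq_sub_of_hasDerivAt hd (Continuous.intervalIntegrable ?_ _ _)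
    refine continuous_const.mul (hf.comp_continuous (by fun_prop) fun x h0 => hc ?_)
    simpa using congrArg Complex.re h0
  have hF : ∀ z ∈ Complex.slitPlane, HasDerivAt (fun z => P z + R * Complex.log z) (f z) z := by
    intro z hz
    convert! (hP z (Complex.slitPlane_ne_zero hz)).add
      ((Complex.hasDerivAt_log hz).const_mul (R : ℂ)) using 1
    ring
  have hG : ∀ z, -z ∈ Complex.slitPlane →
      HasDerivAt (fun z => P z + R * Complex.log (-z)) (f z) z := by
    intro z hz
    have h0 : z ≠ 0 := neg_ne_zero.1 (Complex.slitPlane_ne_zero hz)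
    convert! (hP z h0).add
      (((Complex.hasDerivAt_log hz).comp z (hasDerivAt_neg z)).const_mul (R : ℂ)) using 1
    field_simp
    ring
  rw [hh _ (-y) (by linarith) fun z hz => hF z (Or.inr (by rw [hz]; linarith)),
    hh _ y hy.ne' fun z hz => hF z (Or.inr (by rw [hz]; linarith)),
    hv _ x₂ hx₂.ne' fun z hz => hF z (Or.inl (by rw [hz]; linarith)),
    hv _ x₁ hx₁.ne fun z hz => hG z (Or.inl (by rw [Complex.neg_re, hz]; linarith))]
  have l1 : Complex.log (-(x₁ + y * Complex.I)) =
      Complex.log (x₁ + y * Complex.I) - Real.pi * Complex.I := by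
    rw [Complex.log, Complex.arg_neg_eq_arg_sub_pi_of_im_pos (by simpa using hy), norm_neg,
      Complex.log]
    push_cast; ring
  have l2 : Complex.log (-(x₁ + (-y : ℝ) * Complex.I)) =
      Complex.log (x₁ + (-y : ℝ) * Complex.I) + Real.pi * Complex.I := by
    rw [Complex.log, Complex.arg_neg_eq_arg_add_pi_of_im_neg (by simpa using hy), norm_neg,
      Complex.log]
    push_cast; ring
  rw [l1, l2]
  ring

end HasResidue

/-- `1 / Tⁿ` has a real residue at `0`. -/
theorem exists_hasResidue_T_inv (n : ℕ) : ∃ R, HasResidue (fun z => (T z ^ n)⁻¹) R := by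
  obtain ⟨R, P, hP⟩ := exists_hasResidue_div_pow n (fun z => Complex.exp (-n * ein z))
    ((differentiable_ein.const_mul _).cexp) fun z => by
      rw [ein_conj, ← Complex.exp_conj]; simp
  refine ⟨R, P, fun z hz => ?_⟩
  convert! hP z hz using 2
  beta_reduce
  rw [T, mul_pow, mul_inv, ← Complex.exp_nat_mul, ← Complex.exp_neg, neg_mul]
  field_simp

theorem continuousOn_T_inv (n : ℕ) : ContinuousOn (fun z => (T z ^ n)⁻¹) {0}ᶜ :=
  (differentiable_T.continuous.pow n).continuousOn.inv₀ fun _ hz => pow_ne_zero n (T_ne_zero hz)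

theorem exp_neg_mul_cEi (n : ℕ) {z : ℂ} (hz : z ≠ 0) :
    Complex.exp (-(n : ℂ) * (cEi z - (Real.eulerMascheroniConstant : ℂ))) = (T z ^ n)⁻¹ := by
  rw [cEi, T, neg_mul, Complex.exp_neg, Complex.exp_nat_mul]
  congr 2
  rw [show Complex.log z + (Real.eulerMascheroniConstant : ℂ) + ein z -
    (Real.eulerMascheroniConstant : ℂ) = Complex.log z + ein z by ring, Complex.exp_add,
    Complex.exp_log hz]

theorem exp_neg_mul_ein_div_pow (n : ℕ) (z : ℂ) :
    Complex.exp (-(n : ℂ) * ein z) / z ^ n = (T z ^ n)⁻¹ := by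
  rw [T, mul_pow, mul_inv, ← Complex.exp_nat_mul, ← Complex.exp_neg, neg_mul, div_eq_mul_inv,
    mul_comm]

/-- The residue of `1 / Tⁿ` at `0`. -/
noncomputable def resT (n : ℕ) : ℝ := (exists_hasResidue_T_inv n).choose

theorem hasResidue_resT (n : ℕ) : HasResidue (fun z => (T z ^ n)⁻¹) (resT n) :=
  (exists_hasResidue_T_inv n).choose_spec

theorem residue_cEi (n : ℕ) : residue (fun z => Complex.exp (-(n : ℂ) *
    (cEi z - (Real.eulerMascheroniConstant : ℂ)))) 0 = resT n :=
  (hasResidue_resT n).residue_eq (continuousOn_T_inv n) fun _ hz => exp_neg_mul_cEi n hz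

theorem residue_ein (n : ℕ) :
    residue (fun z => Complex.exp (-(n : ℂ) * ein z) / z ^ n) 0 = resT n :=
  (hasResidue_resT n).residue_eq (continuousOn_T_inv n) fun z _ => exp_neg_mul_ein_div_pow n z

theorem aComplex_eq (n : ℕ) : aComplex n = ((resT n / n : ℝ) : ℂ) := by
  rw [aComplex, residue_cEi]
  push_cast
  ring

theorem a_eq (n : ℕ) : a n = resT n / n := by
  rw [a, aComplex_eq, Complex.ofReal_re]

theorem a_zero : a 0 = 0 := by simp [a_eq]

/-! ### Behaviour of `reEin` at -∞, from Γ'(1) = -γ. -/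

theorem integral_log_mul_exp_neg :
    ∫ t in Set.Ioi (0 : ℝ), Real.log t * Real.exp (-t) = -Real.eulerMascheroniConstant := by
  have h1 := Complex.hasDerivAt_GammaIntegral (s := 1) (by simp)
  have h2 : HasDerivAt Complex.GammaIntegral (-(Real.eulerMascheroniConstant : ℂ)) 1 := by
    refine Complex.hasDerivAt_Gamma_one.congr_of_eventuallyEq ?_
    filter_upwards [Complex.continuous_re.continuousAt.preimage_mem_nhds
      (Ioi_mem_nhds (show (0 : ℝ) < (1 : ℂ).re by simp))] with s hs
    exact (Complex.Gamma_eq_integral hs).symm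
  have h3 := h1.unique h2
  simp only [sub_self, Complex.cpow_zero, one_mul] at h3
  have h4 : ∫ t in Set.Ioi (0 : ℝ), ((Real.log t : ℂ) * (Real.exp (-t) : ℂ)) =
      ((∫ t in Set.Ioi (0 : ℝ), Real.log t * Real.exp (-t) : ℝ) : ℂ) := by
    rw [← integral_complex_ofReal]
    simp
  rw [h4] at h3
  exact_mod_cast h3

theorem integrableOn_log_mul_exp_neg :
    MeasureTheory.IntegrableOn (fun t => Real.log t * Real.exp (-t)) (Set.Ioi (0 : ℝ)) := by
  -- A non-integrable function has integral 0 by convention, but this integral is -γ ≠ 0.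
  by_contra h
  have h1 := integral_log_mul_exp_neg
  rw [MeasureTheory.integral_undef h] at h1
  linarith [Real.one_half_lt_eulerMascheroniConstant]

/-- Integration by parts, with `1 - exp (-t)` as the antiderivative of `exp (-t)` so that the
boundary term at 0 vanishes. -/
theorem intervalIntegral_log_mul_exp_neg {y : ℝ} (hy : 0 < y) :
    ∫ t in (0 : ℝ)..y, Real.log t * Real.exp (-t) =
      (1 - Real.exp (-y)) * Real.log y + reEin (-y) := by
  have hcs : Continuous fun x : ℝ => (expSlope x).re :=
    Complex.continuous_re.comp (differentiable_expSlope.continuous.comp Complex.continuous_ofReal)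
  have hce : Continuous reEin :=
    continuous_iff_continuousAt.2 fun x => (hasDerivAt_reEin x).continuousAt
  -- The form with t log t makes continuity at 0 visible.
  have e : (fun t => (1 - Real.exp (-t)) * Real.log t + reEin (-t)) =
      fun t => (expSlope ((-t : ℝ) : ℂ)).re * (t * Real.log t) + reEin (-t) := by
    funext t
    rcases eq_or_ne t 0 with rfl | ht
    · simp
    · rw [expSlope_ofReal_re (neg_ne_zero.2 ht)]
      field_simp
      ring
  have hc : Continuous fun t => (1 - Real.exp (-t)) * Real.log t + reEin (-t) := by
    rw [e]
    exact ((hcs.comp continuous_neg).mul Real.continuous_mul_log).add (hce.comp continuous_neg)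
  have hd : ∀ t ∈ Set.Ioo 0 y,
      HasDerivAt (fun t => (1 - Real.exp (-t)) * Real.log t + reEin (-t))
        (Real.log t * Real.exp (-t)) t := by
    intro t ht
    have h1 : HasDerivAt (fun t => 1 - Real.exp (-t)) (Real.exp (-t)) t := by
      simpa using (hasDerivAt_neg t).exp.const_sub 1
    have h2 := (hasDerivAt_reEin (-t)).comp t (hasDerivAt_neg t)
    convert! (h1.mul (Real.hasDerivAt_log ht.1.ne')).add h2 using 1
    rw [expSlope_ofReal_re (neg_ne_zero.2 ht.1.ne')]
    have := ht.1.ne'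
    field_simp
    ring
  have hi : IntervalIntegrable (fun t => Real.log t * Real.exp (-t)) MeasureTheory.volume 0 y := by
    rw [intervalIntegrable_iff_integrableOn_Ioc_of_le hy.le]
    exact integrableOn_log_mul_exp_neg.mono_set Set.Ioc_subset_Ioi_self
  rw [intervalIntegral.integral_eq_sub_of_hasDerivAt_of_le hy.le hc.continuousOn hd hi]
  simp [reEin]

/-- This is Ei(x) → 0 at -∞, since `Real.log x` is ln|x| for negative x. -/
theorem tendsto_reEin_add_log :
    Tendsto (fun x => reEin x + Real.log x) atBot (𝓝 (-Real.eulerMascheroniConstant)) := by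
  have h1 := MeasureTheory.intervalIntegral_tendsto_integral_Ioi 0 integrableOn_log_mul_exp_neg
    tendsto_id
  rw [integral_log_mul_exp_neg] at h1
  have h2 : Tendsto (fun y : ℝ => Real.exp (-y) * Real.log y) atTop (𝓝 0) := by
    have h3 : Tendsto (fun y : ℝ => y * Real.exp (-y)) atTop (𝓝 0) := by
      simpa using Real.tendsto_pow_mul_exp_neg_atTop_nhds_zero 1
    refine squeeze_zero_norm' ?_ h3
    filter_upwards [eventually_ge_atTop 1] with y hy
    rw [Real.norm_eq_abs, abs_mul, abs_of_pos (Real.exp_pos _),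
      abs_of_nonneg (Real.log_nonneg hy), mul_comm]
    gcongr
    linarith [Real.log_le_sub_one_of_pos (show 0 < y by linarith)]
  have h4 : Tendsto (fun y : ℝ => reEin (-y) + Real.log (-y)) atTop
      (𝓝 (-Real.eulerMascheroniConstant)) := by
    have := h1.add h2
    rw [add_zero] at this
    refine this.congr' ?_
    filter_upwards [eventually_gt_atTop 0] with y hy
    rw [id, intervalIntegral_log_mul_exp_neg hy, Real.log_neg_eq_log]
    ring
  simpa [Function.comp_def] using h4.comp tendsto_neg_atBot_atTop

/-! ### Lower bounds for U = Re Ei on the sides of the rectangle. -/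

/-- The real part of the exponential integral. -/
noncomputable def U (z : ℂ) : ℝ :=
  (ein z).re + Real.log ‖z‖ + Real.eulerMascheroniConstant

theorem U_conj (z : ℂ) : U (starRingEnd ℂ z) = U z := by
  simp [U, ein_conj]

theorem norm_T {z : ℂ} (hz : z ≠ 0) :
    ‖T z‖ = Real.exp (U z - Real.eulerMascheroniConstant) := by
  rw [T, norm_mul, Complex.norm_exp, U, add_sub_cancel_right, Real.exp_add,
    Real.exp_log (norm_pos_iff.2 hz), mul_comm]

/-- Ei' = eᶻ/z. The branch cut does no harm: ln|z| is the real part of both log z and log(-z), and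
one of z, -z lies in the slit plane. -/
theorem hasDerivAt_U {g : ℝ → ℂ} {g' : ℂ} {t : ℝ} (hg : HasDerivAt g g' t) (h0 : g t ≠ 0) :
    HasDerivAt (fun s => U (g s)) (g' * (Complex.exp (g t) / g t)).re t := by
  have key : ∀ F : ℂ → ℂ, HasDerivAt F (g t)⁻¹ (g t) → (∀ z, (F z).re = Real.log ‖z‖) →
      HasDerivAt (fun s => U (g s)) (g' * (Complex.exp (g t) / g t)).re t := by
    intro F hF hre
    have h1 : HasDerivAt (fun s => ein (g s) + F (g s)) ((expSlope (g t) + (g t)⁻¹) * g') t := by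
      exact ((hasDerivAt_ein (g t)).add hF).comp t hg
    have h2 := (Complex.reCLM.hasFDerivAt.comp_hasDerivAt t h1).add_const
      Real.eulerMascheroniConstant
    convert! h2 using 1
    · funext s
      simp [U, hre]
    · rw [expSlope_of_ne h0]
      simp only [Complex.reCLM_apply]
      congr 1
      field_simp
      ring
  by_cases h : g t ∈ Complex.slitPlane
  · exact key Complex.log (Complex.hasDerivAt_log h) fun z => Complex.log_re z
  · have h' : -g t ∈ Complex.slitPlane :=
      (Complex.mem_slitPlane_or_neg_mem_slitPlane h0).resolve_left h
    refine key (fun z => Complex.log (-z)) ?_ fun z => by rw [Complex.log_re, norm_neg]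
    convert! (Complex.hasDerivAt_log h').comp (g t) (hasDerivAt_neg (g t)) using 1
    field_simp

theorem hasDerivAt_horizontal (x y : ℝ) :
    HasDerivAt (fun x : ℝ => (x : ℂ) + y * Complex.I) 1 x :=
  (hasDerivAt_id (x : ℂ)).comp_ofReal.add_const _

theorem hasDerivAt_vertical (x y : ℝ) :
    HasDerivAt (fun y : ℝ => (x : ℂ) + y * Complex.I) Complex.I y := by
  simpa using ((hasDerivAt_id (y : ℂ)).comp_ofReal.mul_const Complex.I).const_add (x : ℂ)

theorem norm_exp_div_le {x : ℝ} (hx : x < 0) (y : ℝ) :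
    ‖Complex.exp (x + y * Complex.I) / (x + y * Complex.I)‖ ≤ Real.exp x / -x := by
  rw [norm_div, Complex.norm_exp]
  have h : -x ≤ ‖(x : ℂ) + y * Complex.I‖ := by
    have := Complex.abs_re_le_norm ((x : ℂ) + y * Complex.I)
    simp at this
    rwa [abs_of_neg hx] at this
  simp only [Complex.add_re, Complex.ofReal_re, Complex.mul_re, Complex.I_re, mul_zero,
    Complex.ofReal_im, Complex.I_im, mul_one, sub_self, add_zero]
  have : 0 < -x := by linarith
  gcongr

theorem add_mul_I_ne_zero_of_re {x : ℝ} (hx : x ≠ 0) (y : ℝ) : (x : ℂ) + y * Complex.I ≠ 0 :=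
  fun h => hx (by simpa using congrArg Complex.re h)

theorem add_mul_I_ne_zero_of_im (x : ℝ) {y : ℝ} (hy : y ≠ 0) : (x : ℂ) + y * Complex.I ≠ 0 :=
  fun h => hy (by simpa using congrArg Complex.im h)

theorem U_ofReal (x : ℝ) : U x = reEin x + Real.log x + Real.eulerMascheroniConstant := by
  rw [U, ein_ofReal, Complex.ofReal_re, Complex.norm_real, Real.norm_eq_abs, Real.log_abs]

theorem Ei_eq_U (x : ℝ) : Ei x = U x := by
  rw [Ei, U_ofReal, integral_eq_reEin, Real.log_abs]; ring

theorem tendsto_U_ofReal : Tendsto (fun x : ℝ => U x) atBot (𝓝 0) := by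
  simpa [U_ofReal] using tendsto_reEin_add_log.add_const Real.eulerMascheroniConstant

theorem tendsto_exp_div_neg : Tendsto (fun x : ℝ => Real.exp x / -x) atBot (𝓝 0) :=
  Real.tendsto_exp_atBot.div_atTop tendsto_neg_atBot_atTop

/-- Along the vertical segment from x to x + iy, U changes by at most |y| eˣ/|x|, so the limit on
the real axis carries over. -/
theorem tendsto_U_horizontal (y : ℝ) :
    Tendsto (fun x : ℝ => U (x + y * Complex.I)) atBot (𝓝 0) := by
  have h1 : Tendsto (fun x : ℝ => U (x + y * Complex.I) - U x) atBot (𝓝 0) := by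
    have h2 : Tendsto (fun x : ℝ => Real.exp x / -x * ‖y - 0‖) atBot (𝓝 0) := by
      simpa using tendsto_exp_div_neg.mul_const ‖y - 0‖
    refine squeeze_zero_norm' ?_ h2
    filter_upwards [eventually_lt_atBot 0] with x hx
    have := convex_univ.norm_image_sub_le_of_norm_hasDerivWithin_le (𝕜 := ℝ)
      (f := fun t : ℝ => U (x + t * Complex.I))
      (f' := fun t : ℝ => (Complex.I * (Complex.exp (x + t * Complex.I) /
        (x + t * Complex.I))).re) (C := Real.exp x / -x) (x := 0) (y := y)
      (fun t _ => (hasDerivAt_U (hasDerivAt_vertical x t)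
        (add_mul_I_ne_zero_of_re hx.ne t)).hasDerivWithinAt)
      (fun t _ => by
        refine (Complex.abs_re_le_norm _).trans ?_
        rw [norm_mul, Complex.norm_I, one_mul]
        exact norm_exp_div_le hx t) trivial trivial
    simpa using this
  simpa using h1.add tendsto_U_ofReal

theorem nonneg_of_deriv_nonneg_of_tendsto_atBot {f f' : ℝ → ℝ} {b : ℝ}
    (hf : ∀ x ≤ b, HasDerivAt f (f' x) x) (hf' : ∀ x ≤ b, 0 ≤ f' x)
    (hlim : Tendsto f atBot (𝓝 0)) : 0 ≤ f b := by
  have hm : MonotoneOn f (Set.Iic b) := by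
    refine monotoneOn_of_deriv_nonneg (convex_Iic b)
      (fun x hx => (hf x hx).continuousAt.continuousWithinAt)
      (fun x hx => ?_) (fun x hx => ?_)
    · exact (hf x (interior_subset (s := Set.Iic b) hx)).differentiableAt.differentiableWithinAt
    · have hx' : x ≤ b := interior_subset (s := Set.Iic b) hx
      rw [(hf x hx').deriv]
      exact hf' x hx'
  exact le_of_tendsto hlim (by
    filter_upwards [eventually_le_atBot b] with x hx using hm hx (Set.mem_Iic.2 le_rfl) hx)

/-- The sum of U and eˣ/(-x) tends to 0 at -∞ and is nondecreasing, because the derivative of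
eˣ/(-x) is at least |eᶻ/z|. -/
theorem exp_div_le_U {x : ℝ} (hx : x < 0) (y : ℝ) : Real.exp x / x ≤ U (x + y * Complex.I) := by
  have hd : ∀ s ≤ x, HasDerivAt (fun s : ℝ => U (s + y * Complex.I) + Real.exp s / -s)
      ((Complex.exp (s + y * Complex.I) / (s + y * Complex.I)).re
        + (Real.exp s * -s - Real.exp s * -1) / (-s) ^ 2) s := fun s hs => by
    have h0 : s ≠ 0 := by linarith
    have h1 := hasDerivAt_U (hasDerivAt_horizontal s y) (add_mul_I_ne_zero_of_re h0 y)
    rw [one_mul] at h1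
    exact h1.add ((Real.hasDerivAt_exp s).div (hasDerivAt_neg s) (neg_ne_zero.2 h0))
  have := nonneg_of_deriv_nonneg_of_tendsto_atBot hd (fun s hs => ?_) (by
    simpa using (tendsto_U_horizontal y).add tendsto_exp_div_neg)
  · rw [div_neg] at this
    linarith
  · have hs0 : 0 < -s := by linarith
    have h1 := (abs_le.1 ((Complex.abs_re_le_norm _).trans
      (norm_exp_div_le (show s < 0 by linarith) y))).1
    have h2 : (Real.exp s * -s - Real.exp s * -1) / (-s) ^ 2 =
        Real.exp s / -s + Real.exp s / (-s) ^ 2 := by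
      field_simp
      ring
    have h3 : 0 ≤ Real.exp s / (-s) ^ 2 := by positivity
    linarith

theorem re_exp_div (x y : ℝ) : (Complex.exp (x + y * Complex.I) / (x + y * Complex.I)).re =
    Real.exp x * (x * Real.cos y + y * Real.sin y) / (x ^ 2 + y ^ 2) := by
  rw [Complex.div_re, Complex.exp_re, Complex.exp_im, Complex.normSq_apply]
  simp
  ring

theorem im_exp_div (x y : ℝ) : (Complex.exp (x + y * Complex.I) / (x + y * Complex.I)).im =
    Real.exp x * (x * Real.sin y - y * Real.cos y) / (x ^ 2 + y ^ 2) := by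
  rw [Complex.div_im, Complex.exp_re, Complex.exp_im, Complex.normSq_apply]
  simp
  ring

/-- At height h = 3π/4 the cosine is minus the sine, so Re(eᶻ/z) = (√2/2) eˣ (h - x)/(x² + h²),
which is positive for x < h. It dominates the derivative of the comparison function for x ≤ 1, and
both functions tend to 0 at -∞. -/
theorem exp_div_le_U_horizontal {x : ℝ} (hx : x ≤ 1) :
    Real.exp x / (16 * (3 * Real.pi / 4 - x)) ≤ U (x + (3 * Real.pi / 4 : ℝ) * Complex.I) := by
  have p1 := Real.pi_gt_d2
  have p2 := Real.pi_lt_d2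
  set h : ℝ := 3 * Real.pi / 4 with hh
  have h1 : 2.35 < h := by linarith
  have h2 : h < 2.37 := by linarith
  have hcos : Real.cos h = -(√2 / 2) := by
    rw [hh, show 3 * Real.pi / 4 = Real.pi - Real.pi / 4 by ring, Real.cos_pi_sub,
      Real.cos_pi_div_four]
  have hsin : Real.sin h = √2 / 2 := by
    rw [hh, show 3 * Real.pi / 4 = Real.pi - Real.pi / 4 by ring, Real.sin_pi_sub,
      Real.sin_pi_div_four]
  have hsqrt : (1.4 : ℝ) ≤ √2 := Real.le_sqrt_of_sq_le (by norm_num)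
  have hd : ∀ s ≤ x, HasDerivAt
      (fun s : ℝ => U (s + h * Complex.I) - Real.exp s / (16 * (h - s)))
      ((Complex.exp (s + h * Complex.I) / (s + h * Complex.I)).re
        - (Real.exp s * (16 * (h - s)) - Real.exp s * (16 * -1)) / (16 * (h - s)) ^ 2) s :=
    fun s hs => by
    have h3 := hasDerivAt_U (hasDerivAt_horizontal s h) (add_mul_I_ne_zero_of_im s (by linarith))
    rw [one_mul] at h3
    exact h3.sub ((Real.hasDerivAt_exp s).div (((hasDerivAt_id s).const_sub h).const_mul 16)
      (by linarith))
  have hl : Tendsto (fun s : ℝ => Real.exp s / (16 * (h - s))) atBot (𝓝 0) :=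
    Real.tendsto_exp_atBot.div_atTop
      ((tendsto_atTop_add_const_left _ h tendsto_neg_atBot_atTop).const_mul_atTop (by norm_num))
  have := nonneg_of_deriv_nonneg_of_tendsto_atBot hd (fun s hs => ?_) (by
    simpa using (tendsto_U_horizontal h).sub hl)
  · linarith
  · rw [re_exp_div, hcos, hsin]
    obtain ⟨d, rfl⟩ : ∃ d, s = h - d := ⟨h - s, by ring⟩
    have hd1 : 1.35 < d := by linarith
    rw [sub_sub_cancel, sub_nonneg,
      show Real.exp (h - d) * (16 * d) - Real.exp (h - d) * (16 * -1) =
        Real.exp (h - d) * (16 * (d + 1)) by ring,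
      show Real.exp (h - d) * ((h - d) * -(√2 / 2) + h * (√2 / 2)) =
        Real.exp (h - d) * (√2 / 2 * d) by ring, mul_div_assoc,
      mul_div_assoc (Real.exp (h - d))]
    refine mul_le_mul_of_nonneg_left ?_ (Real.exp_pos _).le
    have hq : (h - d) ^ 2 + h ^ 2 ≤ 4 * d ^ 2 := by nlinarith
    calc 16 * (d + 1) / (16 * d) ^ 2 ≤ 1.4 / 2 * d / (4 * d ^ 2) := by
          rw [div_le_div_iff₀ (by positivity) (by positivity)]
          nlinarith [mul_pos (show 0 < d by linarith) (show 0 < d by linarith)]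
      _ ≤ √2 / 2 * d / ((h - d) ^ 2 + h ^ 2) := by gcongr

/-- Going up the line Re z = 1, U decreases because t cos t ≤ sin t on [0, π]; so it suffices to
look at the corner, where the horizontal bound is positive. -/
theorem U_vertical_nonneg {y : ℝ} (h0 : 0 ≤ y) (hy : y ≤ 3 * Real.pi / 4) :
    0 ≤ U ((1 : ℝ) + y * Complex.I) := by
  have hp := Real.pi_pos
  have h1 := exp_div_le_U_horizontal le_rfl
  have h2 : 0 ≤ Real.exp 1 / (16 * (3 * Real.pi / 4 - 1)) := by
    have : 0 < 3 * Real.pi / 4 - 1 := by linarith [Real.pi_gt_three]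
    positivity
  refine (h2.trans h1).trans ?_
  have hd : ∀ t : ℝ, HasDerivAt (fun t : ℝ => U ((1 : ℝ) + t * Complex.I))
      (Complex.I * (Complex.exp ((1 : ℝ) + t * Complex.I) / ((1 : ℝ) + t * Complex.I))).re t :=
    fun t => hasDerivAt_U (hasDerivAt_vertical 1 t) (add_mul_I_ne_zero_of_re one_ne_zero t)
  have ha : AntitoneOn (fun t : ℝ => U ((1 : ℝ) + t * Complex.I)) (Set.Icc 0 Real.pi) := by
    refine antitoneOn_of_deriv_nonpos (convex_Icc _ _)
      (fun t _ => (hd t).continuousAt.continuousWithinAt)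
      (fun t _ => (hd t).differentiableAt.differentiableWithinAt) fun t ht => ?_
    rw [interior_Icc] at ht
    rw [(hd t).deriv, Complex.I_mul_re, im_exp_div]
    have : t * Real.cos t ≤ 1 * Real.sin t := by
      rw [one_mul]
      have hs : 0 < Real.sin t := Real.sin_pos_of_pos_of_lt_pi ht.1 ht.2
      rcases lt_or_ge t (Real.pi / 2) with h | h
      · have hc : 0 < Real.cos t := Real.cos_pos_of_mem_Ioo ⟨by linarith [ht.1], h⟩
        have := Real.le_tan ht.1.le h
        rwa [Real.tan_eq_sin_div_cos, le_div_iff₀ hc] at this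
      · have := Real.cos_nonpos_of_pi_div_two_le_of_le h (by linarith [ht.2])
        nlinarith [ht.1]
    have : 0 ≤ 1 * Real.sin t - t * Real.cos t := by linarith
    rw [neg_nonpos]
    positivity
  exact ha ⟨h0, by linarith⟩ ⟨by linarith, by linarith⟩ hy

/-! ### The contour estimate for the residues of T⁻ⁿ. -/

theorem norm_T_pow_inv_le (n : ℕ) {z : ℂ} (hz : z ≠ 0) {c : ℝ} (hc : c ≤ n * U z) :
    ‖(T z ^ n)⁻¹‖ ≤ Real.exp (Real.eulerMascheroniConstant * n) * Real.exp (-c) := by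
  rw [norm_inv, norm_pow, norm_T hz, ← Real.exp_nat_mul, ← Real.exp_neg, ← Real.exp_add,
    Real.exp_le_exp]
  linarith

theorem U_neg_im (x y : ℝ) : U (x + (-y : ℝ) * Complex.I) = U (x + y * Complex.I) := by
  rw [← U_conj (x + y * Complex.I)]
  simp

/-- Places the left side of the rectangle: for c = n the bound U ≥ -e^{-X}/X becomes nU ≥ -1. -/
theorem exists_mul_exp_eq {c : ℝ} (hc : 1 ≤ c) : ∃ X : ℝ, 1 / 2 ≤ X ∧ X * Real.exp X = c := by
  have hcont : ContinuousOn (fun x : ℝ => x * Real.exp x) (Set.Icc (1 / 2) c) := by fun_prop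
  have h1 : Real.exp (1 / 2) * Real.exp (1 / 2) < 4 := by
    rw [← Real.exp_add, add_halves]
    linarith [Real.exp_one_lt_d9]
  have h2 : Real.exp (1 / 2) < 2 := by nlinarith [Real.exp_pos (1 / 2)]
  have h3 := Real.one_le_exp (show 0 ≤ c by linarith)
  have hmem : c ∈ Set.Icc (1 / 2 * Real.exp (1 / 2)) (c * Real.exp c) :=
    ⟨by linarith, by nlinarith⟩
  obtain ⟨X, hX, h⟩ := intermediate_value_Icc (by linarith) hcont hmem
  exact ⟨X, hX.1, h⟩

theorem integral_exp_neg_shift_le (X : ℝ) {K : ℝ} (hK : 0 < K) :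
    ∫ x in -X..1, Real.exp (-((x + X) / K)) ≤ K := by
  have hd : ∀ x ∈ Set.uIcc (-X) 1, HasDerivAt (fun x => -K * Real.exp (-((x + X) / K)))
      (Real.exp (-((x + X) / K))) x := fun x _ => by
    have := (((((hasDerivAt_id x).add_const X).div_const K).neg).exp).const_mul (-K)
    convert! this using 1
    simp only [Pi.neg_apply, id]
    field_simp
  rw [intervalIntegral.integral_eq_sub_of_hasDerivAt hd
    (Continuous.intervalIntegrable (by fun_prop) _ _)]
  have : 0 ≤ K * Real.exp (-((1 + X) / K)) := by positivity
  simp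
  linarith

theorem exists_abs_resT_le :
    ∃ C : ℝ, ∀ n : ℕ, 1 ≤ n →
      |resT n| ≤ C * Real.exp (Real.eulerMascheroniConstant * n) := by
  set h : ℝ := 3 * Real.pi / 4 with hh
  have p1 := Real.pi_gt_d2
  have p2 := Real.pi_lt_d2
  have h1 : 2.35 < h := by linarith
  have h2 : h < 2.37 := by linarith
  -- Each horizontal side contributes 96, the right side its length 2h, and the left side 2h·e.
  refine ⟨(192 + 2 * h + 2 * h * Real.exp 1) / (2 * Real.pi), fun n hn => ?_⟩
  have hn' : (1 : ℝ) ≤ n := by exact_mod_cast hn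
  obtain ⟨X, hX, hXn⟩ := exists_mul_exp_eq hn'
  set E := Real.exp (Real.eulerMascheroniConstant * n) with hE
  have hEpos : 0 < E := Real.exp_pos _
  have key := (hasResidue_resT n).rect_integral_eq (continuousOn_T_inv n) (x₁ := -X) (x₂ := 1)
    (y := h) (by linarith) one_pos (by linarith)
  have hnU : ∀ x : ℝ, -X ≤ x → x ≤ 1 → (x + X) / 96 ≤ n * U (x + h * Complex.I) := by
    intro x hx hx1
    have hU := exp_div_le_U_horizontal hx1
    rw [← hh] at hU
    have hpos : 0 < h - x := by linarith
    calc (x + X) / 96 ≤ X * (x + X) / (16 * (h - x)) := by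
          rw [div_le_div_iff₀ (by norm_num) (by positivity)]
          -- Here h - x ≤ h + X ≤ 6X, from h < 2.37 and X ≥ 1/2; this is the origin of 96 = 16·6.
          have : 16 * (h - x) ≤ X * 96 := by linarith
          nlinarith
      _ ≤ X * Real.exp (x + X) / (16 * (h - x)) := by
          have := Real.add_one_le_exp (x + X)
          gcongr
          linarith
      _ = n * (Real.exp x / (16 * (h - x))) := by
          rw [← hXn, Real.exp_add]
          ring
      _ ≤ _ := by gcongr
  have horiz : ∀ s : ℝ, s = h ∨ s = -h →
      ‖∫ x in -X..1, (T (x + s * Complex.I) ^ n)⁻¹‖ ≤ E * 96 := by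
    intro s hs
    have hs0 : s ≠ 0 := by rcases hs with rfl | rfl <;> linarith
    have hle : ‖∫ x in -X..1, (T (x + s * Complex.I) ^ n)⁻¹‖ ≤
        ∫ x in -X..1, E * Real.exp (-((x + X) / 96)) := by
      refine intervalIntegral.norm_integral_le_of_norm_le (by linarith)
        (Eventually.of_forall fun x hx => ?_) (Continuous.intervalIntegrable (by fun_prop) _ _)
      refine norm_T_pow_inv_le n (add_mul_I_ne_zero_of_im x hs0) ?_
      rcases hs with rfl | rfl
      · exact hnU x hx.1.le hx.2
      · rw [U_neg_im]; exact hnU x hx.1.le hx.2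
    refine hle.trans ?_
    rw [intervalIntegral.integral_const_mul]
    exact mul_le_mul_of_nonneg_left (integral_exp_neg_shift_le X (by norm_num)) hEpos.le
  have hright : ‖∫ t in -h..h, (T ((1 : ℝ) + t * Complex.I) ^ n)⁻¹‖ ≤ E * (2 * h) := by
    have := intervalIntegral.norm_integral_le_of_norm_le_const (a := -h) (b := h) (C := E)
      (f := fun t : ℝ => (T ((1 : ℝ) + t * Complex.I) ^ n)⁻¹) fun t ht => by
        rw [Set.uIoc_of_le (by linarith)] at ht
        have hU : 0 ≤ U ((1 : ℝ) + t * Complex.I) := by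
          rcases le_total 0 t with h0 | h0
          · exact U_vertical_nonneg h0 ht.2
          · rw [← U_neg_im]
            exact U_vertical_nonneg (by linarith) (by linarith [ht.1])
        have := norm_T_pow_inv_le n (add_mul_I_ne_zero_of_re one_ne_zero t) (c := 0)
          (by positivity)
        simpa using this
    rwa [sub_neg_eq_add, abs_of_pos (by linarith), ← two_mul] at this
  have hleft : ‖∫ t in -h..h, (T ((-X : ℝ) + t * Complex.I) ^ n)⁻¹‖
      ≤ E * Real.exp 1 * (2 * h) := by
    have := intervalIntegral.norm_integral_le_of_norm_le_const (a := -h) (b := h)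
      (C := E * Real.exp 1)
      (f := fun t : ℝ => (T ((-X : ℝ) + t * Complex.I) ^ n)⁻¹) fun t ht => by
        have hX0 : -X < 0 := by linarith
        have hU := exp_div_le_U hX0 t
        have := norm_T_pow_inv_le n (add_mul_I_ne_zero_of_re hX0.ne t) (c := -1) (by
          refine le_trans (le_of_eq ?_) (mul_le_mul_of_nonneg_left hU (by positivity))
          have : X ≠ 0 := by linarith
          rw [← hXn, Real.exp_neg]
          field_simp)
        simpa using this
    rwa [sub_neg_eq_add, abs_of_pos (by linarith), ← two_mul] at this
  have hR : 2 * Real.pi * |resT n| ≤ E * 96 + E * 96 + E * (2 * h) + E * Real.exp 1 * (2 * h) := by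
    have e : ‖(2 * Real.pi * Complex.I * resT n : ℂ)‖ = 2 * Real.pi * |resT n| := by
      simp [abs_of_pos Real.pi_pos]
    rw [← e, ← key]
    refine (norm_sub_le _ _).trans (add_le_add ((norm_add_le _ _).trans (add_le_add
      ((norm_sub_le _ _).trans (add_le_add (horiz _ (Or.inr rfl)) (horiz _ (Or.inl rfl)))) ?_)) ?_)
    · rw [norm_mul, Complex.norm_I, one_mul]; exact hright
    · rw [norm_mul, Complex.norm_I, one_mul]; exact hleft
  rw [div_mul_eq_mul_div, le_div_iff₀ (by positivity)]
  linarith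

theorem exists_abs_a_le : ∃ C : ℝ, 0 ≤ C ∧ ∀ n : ℕ,
    |a n| * Real.exp (-Real.eulerMascheroniConstant * n) ≤ C / n := by
  obtain ⟨C, hC⟩ := exists_abs_resT_le
  refine ⟨|C|, abs_nonneg C, fun n => ?_⟩
  rcases Nat.eq_zero_or_pos n with rfl | hn
  · simp [a_zero]
  · rw [a_eq, abs_div, Nat.abs_cast, div_mul_eq_mul_div, neg_mul, Real.exp_neg,
      ← div_eq_mul_inv]
    gcongr
    rw [div_le_iff₀ (Real.exp_pos _)]
    refine (hC n hn).trans ?_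
    gcongr
    exact le_abs_self C

/-! ### Lagrange inversion. -/

/-- The remainder factor is the iterated `dslope`, so the expansion is an identity at every point,
not only near 0. -/
theorem _root_.HasFPowerSeriesAt.exists_eq_sum_add_pow_mul {f : ℂ → ℂ}
    {p : FormalMultilinearSeries ℂ ℂ ℂ} (hp : HasFPowerSeriesAt f p 0) (n : ℕ) :
    ∃ h : ℂ → ℂ, AnalyticAt ℂ h 0 ∧
      ∀ w, f w = ∑ k ∈ Finset.range n, p.coeff k * w ^ k + w ^ n * h w := by
  refine ⟨(Function.swap dslope 0)^[n] f,
    (hp.has_fpower_series_iterate_dslope_fslope n).analyticAt, ?_⟩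
  induction n with
  | zero => simp
  | succ n ih =>
    intro w
    rw [ih w, Finset.sum_range_succ, Function.iterate_succ_apply']
    set g := (Function.swap dslope 0)^[n] f with hg
    have h0 : g 0 = p.coeff n := by
      have := (hp.has_fpower_series_iterate_dslope_fslope n).coeff_zero 1
      rw [hg, ← this, ← FormalMultilinearSeries.coeff, FormalMultilinearSeries.coeff_iterate_fslope,
        zero_add]
    have h1 := sub_smul_dslope g 0 w
    simp only [sub_zero, smul_eq_mul, h0] at h1
    rw [Function.swap]
    linear_combination w ^ n * (-h1)

/-- Lagrange inversion for `T`. -/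
theorem mul_coeff_eq_resT {ψ : ℂ → ℂ} {p : FormalMultilinearSeries ℂ ℂ ℂ}
    (hp : HasFPowerSeriesAt ψ p 0) (hψ : ∀ᶠ z in 𝓝 (0 : ℂ), ψ (T z) = z) (n : ℕ) :
    n * p.coeff n = resT n := by
  obtain ⟨h, hh, hexp⟩ := hp.exists_eq_sum_add_pow_mul (n + 1)
  obtain ⟨P, hP⟩ := hasResidue_resT n
  set T' : ℂ → ℂ := fun z => Complex.exp (ein z) * Complex.exp z with hT'
  have hT : ∀ z, HasDerivAt T (T' z) z := hasDerivAt_T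
  have hg : AnalyticAt ℂ (fun z => h (T z)) 0 := by
    refine AnalyticAt.fun_comp ?_ (differentiable_T.analyticAt 0)
    rwa [T_zero]
  obtain ⟨δ, hδ, hball⟩ := Metric.eventually_nhds_iff_ball.1
    (hψ.and hg.eventually_analyticAt)
  set g : ℂ → ℂ := fun z => h (T z) with hgdef
  set K : ℂ → ℂ := fun z => (n + 1) * T' z * g z + T z * deriv g z with hK
  have hKd : DifferentiableOn ℂ K (Metric.ball 0 δ) := fun z hz => by
    have a1 := (hball z hz).2
    have a2 : DifferentiableAt ℂ T' z :=
      (differentiable_ein.cexp.mul Complex.differentiable_exp) z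
    exact (((a2.const_mul ((n : ℂ) + 1)).mul a1.differentiableAt).add
      ((differentiable_T z).mul a1.deriv.differentiableAt)).differentiableWithinAt
  obtain ⟨Q, hQ⟩ := hKd.isExactOn_ball
  -- The derivative of z = ψ(T z), with ψ expanded to order n; the remainder keeps a factor Tⁿ.
  have hE : ∀ z ∈ Metric.ball (0 : ℂ) δ,
      1 = ∑ k ∈ Finset.range (n + 1), p.coeff k * (k * T z ^ (k - 1) * T' z)
        + T z ^ n * K z := by
    intro z hz
    have h1 : HasDerivAt (fun z => ∑ k ∈ Finset.range (n + 1), p.coeff k * T z ^ k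
        + T z ^ (n + 1) * g z)
        (∑ k ∈ Finset.range (n + 1), p.coeff k * (k * T z ^ (k - 1) * T' z)
        + (((n + 1 : ℕ) : ℂ) * T z ^ (n + 1 - 1) * T' z * g z + T z ^ (n + 1) * deriv g z)) z := by
      refine (HasDerivAt.fun_sum fun k _ => ((hT z).pow k).const_mul _).add ?_
      exact ((hT z).pow (n + 1)).mul (hball z hz).2.differentiableAt.hasDerivAt
    have h2 : HasDerivAt (fun z => ∑ k ∈ Finset.range (n + 1), p.coeff k * T z ^ k
        + T z ^ (n + 1) * g z) 1 z := by
      refine (hasDerivAt_id z).congr_of_eventuallyEq ?_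
      filter_upwards [Metric.isOpen_ball.mem_nhds hz] with y hy
      rw [id, ← hexp (T y), (hball y hy).1]
    rw [h2.unique h1]
    simp only [hK, Nat.add_sub_cancel]
    push_cast
    ring
  -- After division by Tⁿ the terms with k < n are derivatives of powers of 1/T, and k = n gives n
  -- cₙ T'/T = n cₙ (1/z + `expSlope z`). Comparison with P leaves a multiple of 1/z with a
  -- primitive on the punctured disc, so its coefficient vanishes.
  have hW : ∀ z ∈ Metric.ball (0 : ℂ) δ, z ≠ 0 → HasDerivAt
      (fun z => -P z + ∑ k ∈ Finset.range n, -(k * p.coeff k / ((n - k : ℕ) : ℂ)) *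
        (T z ^ (n - k))⁻¹ + n * p.coeff n * ein z + Q z)
      ((resT n - n * p.coeff n) / z) z := by
    intro z hz h0
    have hTz := T_ne_zero h0
    have d1 : HasDerivAt (fun z => ∑ k ∈ Finset.range n, -(k * p.coeff k / ((n - k : ℕ) : ℂ)) *
        (T z ^ (n - k))⁻¹) (∑ k ∈ Finset.range n, -(k * p.coeff k / ((n - k : ℕ) : ℂ)) *
          (-(((n - k : ℕ) : ℂ) * T z ^ (n - k - 1) * T' z) / (T z ^ (n - k)) ^ 2)) z :=
      HasDerivAt.fun_sum fun k _ =>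
        (((hT z).pow (n - k)).inv (pow_ne_zero _ hTz)).const_mul _
    have d := (((hP z h0).neg.add d1).add ((hasDerivAt_ein z).const_mul (n * p.coeff n))).add
      (hQ z hz)
    convert! d using 1
    have hs : ∑ k ∈ Finset.range n, -(k * p.coeff k / ((n - k : ℕ) : ℂ)) *
          (-(((n - k : ℕ) : ℂ) * T z ^ (n - k - 1) * T' z) / (T z ^ (n - k)) ^ 2) =
        (T z ^ n)⁻¹ * ∑ k ∈ Finset.range n, p.coeff k * (k * T z ^ (k - 1) * T' z) := by
      rw [Finset.mul_sum]
      refine Finset.sum_congr rfl fun k hk => ?_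
      rw [Finset.mem_range] at hk
      obtain ⟨m, rfl⟩ : ∃ m, n = k + (m + 1) := ⟨n - k - 1, by omega⟩
      rw [Nat.add_sub_cancel_left, Nat.add_sub_cancel]
      rcases k with _ | k
      · simp
      · have hm : ((m + 1 : ℕ) : ℂ) ≠ 0 := by exact_mod_cast Nat.succ_ne_zero m
        rw [Nat.add_sub_cancel]
        field_simp
        ring
    have hE' := hE z hz
    rw [Finset.sum_range_succ] at hE'
    have hT'T : (n : ℂ) * T z ^ (n - 1) * T' z = n * T z ^ n * (1 / z + expSlope z) := by
      rcases n with _ | n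
      · simp
      · rw [Nat.add_sub_cancel, pow_succ]
        have : T' z = T z * (1 / z + expSlope z) := by
          have hz1 := mul_expSlope z
          have hz2 : Complex.exp z = 1 + z * expSlope z := by rw [hz1]; ring
          simp only [hT']
          rw [hz2, T]
          field_simp
        rw [this]
        ring
    rw [hT'T] at hE'
    rw [hs]
    set S := ∑ k ∈ Finset.range n, p.coeff k * (k * T z ^ (k - 1) * T' z)
    have e := congrArg (fun t => (T z ^ n)⁻¹ * t) hE'
    beta_reduce at e ⊢
    linear_combination e + (n * p.coeff n * (1 / z + expSlope z) + K z) *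
      inv_mul_cancel₀ (pow_ne_zero n hTz)
  have hs : ∀ z ∈ Metric.sphere (0 : ℂ) (δ / 2), z ∈ Metric.ball (0 : ℂ) δ ∧ z ≠ 0 := by
    intro z hz
    rw [mem_sphere_zero_iff_norm] at hz
    constructor
    · rw [mem_ball_zero_iff, hz]; linarith
    · rw [← norm_pos_iff, hz]; linarith
  have hint := circleIntegral.integral_eq_zero_of_hasDerivWithinAt (c := 0) (by positivity)
    fun z hz => (hW z (hs z hz).1 (hs z hz).2).hasDerivWithinAt
  have h2 := circleIntegral.integral_sub_center_inv (0 : ℂ) (show δ / 2 ≠ 0 by positivity)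
  simp only [sub_zero] at h2
  simp only [div_eq_mul_inv (_ - _)] at hint
  rw [circleIntegral.integral_const_mul, h2] at hint
  have := (mul_eq_zero.1 hint).resolve_right Complex.two_pi_I_ne_zero
  linear_combination -this

theorem exists_localInverse_T : ∃ ψ : ℂ → ℂ,
    HasFPowerSeriesAt ψ (FormalMultilinearSeries.ofScalars ℂ (fun n => (a n : ℂ))) 0 ∧
      (∀ᶠ z in 𝓝 (0 : ℂ), T (ψ z) = z) ∧ (∀ᶠ z in 𝓝 (0 : ℂ), ψ (T z) = z) := by
  have hT : AnalyticAt ℂ T 0 := differentiable_T.analyticAt 0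
  have hd : deriv T 0 ≠ 0 := by
    rw [(hasDerivAt_T 0).deriv]
    exact mul_ne_zero (Complex.exp_ne_zero _) (Complex.exp_ne_zero _)
  have h1 := hT.analyticAt_localInverse hd
  have h2 := hT.hasStrictDerivAt.eventually_left_inverse hd
  have h3 := hT.hasStrictDerivAt.eventually_right_inverse hd
  set ψ := hT.hasStrictDerivAt.localInverse _ _ _ hd
  rw [T_zero] at h1 h3
  have hp := h1.hasFPowerSeriesAt
  refine ⟨ψ, ?_, h3, h2⟩
  convert! hp using 2
  funext n
  rcases Nat.eq_zero_or_pos n with rfl | hn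
  · have h0 := h2.self_of_nhds
    rw [T_zero] at h0
    simp [a_zero, h0]
  · have hc := mul_coeff_eq_resT hp h2 n
    rw [FormalMultilinearSeries.coeff_ofScalars] at hc
    have hn0 : (n : ℂ) ≠ 0 := by exact_mod_cast hn.ne'
    rw [a_eq, Complex.ofReal_div, Complex.ofReal_natCast, ← hc]
    field_simp

/-! ### Real power series: Abel means, termwise differentiation, constancy. -/

/-- Tauber's comparison at r = 1 - 1/(N+1). In the head, |bₙ|(1 - rⁿ) ≤ n|bₙ|(1 - r) ≤ C/(N+1) for
each of N+1 terms; the tail is at most C/(N+1) times a geometric series of sum N+1. -/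
theorem abs_tsum_pow_sub_sum_le {b : ℕ → ℝ} {C : ℝ} (hC : 0 ≤ C) (hb : ∀ n, |b n| ≤ C / n)
    (N : ℕ) :
    |∑' n, b n * (1 - 1 / ((N : ℝ) + 1)) ^ n - ∑ n ∈ Finset.range (N + 1), b n| ≤ 2 * C := by
  set r : ℝ := 1 - 1 / ((N : ℝ) + 1) with hr
  have hN : (0 : ℝ) < N + 1 := by positivity
  have hr0 : 0 ≤ r := by
    rw [hr, sub_nonneg, div_le_one hN]
    linarith [(Nat.cast_nonneg N : (0 : ℝ) ≤ N)]
  have h1r : 1 - r = 1 / ((N : ℝ) + 1) := by rw [hr]; ring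
  have hr1 : r < 1 := by
    have : 0 < 1 - r := by rw [h1r]; positivity
    linarith
  have hbn : ∀ n, |b n| * n ≤ C := fun n => by
    rcases Nat.eq_zero_or_pos n with rfl | hn
    · simpa using hC
    · have : (0 : ℝ) < n := by exact_mod_cast hn
      exact (le_div_iff₀ this).1 (hb n)
  have hbC : ∀ n, N + 1 ≤ n → |b n * r ^ n| ≤ C / (N + 1) * r ^ (n - (N + 1)) := fun n hn => by
    rw [abs_mul, abs_of_nonneg (pow_nonneg hr0 n)]
    have h1 : |b n| ≤ C / (N + 1) := (hb n).trans (by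
      have : ((N + 1 : ℕ) : ℝ) ≤ n := by exact_mod_cast hn
      push_cast at this
      gcongr)
    have h2 : r ^ n ≤ r ^ (n - (N + 1)) := pow_le_pow_of_le_one hr0 hr1.le (Nat.sub_le _ _)
    gcongr
  have htail : HasSum (fun k : ℕ => C / (N + 1) * r ^ k) C := by
    convert! (hasSum_geometric_of_lt_one hr0 hr1).mul_left (C / ((N : ℝ) + 1)) using 1
    rw [h1r]
    field_simp
  have hshift : ∀ k : ℕ, ‖b (k + (N + 1)) * r ^ (k + (N + 1))‖ ≤ C / (N + 1) * r ^ k := fun k => by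
    have := hbC (k + (N + 1)) (by omega)
    rwa [Nat.add_sub_cancel] at this
  have hsum : Summable fun n => b n * r ^ n :=
    (summable_nat_add_iff (N + 1)).1 (Summable.of_norm_bounded htail.summable hshift)
  have h3 : ‖∑' k, b (k + (N + 1)) * r ^ (k + (N + 1))‖ ≤ C := tsum_of_norm_bounded htail hshift
  have h4 : |∑ n ∈ Finset.range (N + 1), (b n * r ^ n - b n)| ≤ C := by
    calc _ ≤ ∑ n ∈ Finset.range (N + 1), |b n * r ^ n - b n| := Finset.abs_sum_le_sum_abs _ _
      _ ≤ ∑ n ∈ Finset.range (N + 1), C * (1 - r) := by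
          refine Finset.sum_le_sum fun n _ => ?_
          have h5 : 1 - r ^ n ≤ n * (1 - r) := by
            have := one_add_mul_le_pow (show -2 ≤ r - 1 by linarith) n
            rw [add_sub_cancel] at this
            linarith
          have h6 : r ^ n ≤ 1 := pow_le_one₀ hr0 hr1.le
          rw [show b n * r ^ n - b n = -(b n * (1 - r ^ n)) by ring, abs_neg, abs_mul,
            abs_of_nonneg (sub_nonneg.2 h6)]
          calc |b n| * (1 - r ^ n) ≤ |b n| * (n * (1 - r)) := by gcongr
            _ = |b n| * n * (1 - r) := by ring
            _ ≤ C * (1 - r) := mul_le_mul_of_nonneg_right (hbn n) (by linarith)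
      _ = C := by
          rw [Finset.sum_const, Finset.card_range, h1r, nsmul_eq_mul]
          push_cast
          field_simp
  rw [← hsum.sum_add_tsum_nat_add (N + 1), add_sub_right_comm, ← Finset.sum_sub_distrib]
  refine (abs_add_le _ _).trans ?_
  rw [Real.norm_eq_abs] at h3
  linarith

theorem summable_mul_pow {c : ℕ → ℝ} {ρ C : ℝ} (hρ : 0 < ρ) (hc : ∀ n, |c n| * ρ ^ n ≤ C) {w : ℝ}
    (hw : |w| < ρ) : Summable fun n => |c n| * |w| ^ n := by
  have hq : |w| / ρ < 1 := (div_lt_one hρ).2 hw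
  refine Summable.of_nonneg_of_le (fun n => by positivity) (fun n => ?_)
    ((summable_geometric_of_lt_one (by positivity) hq).mul_left C)
  calc |c n| * |w| ^ n = |c n| * ρ ^ n * (|w| / ρ) ^ n := by
        rw [div_pow]; field_simp
    _ ≤ _ := by
        have := hc n
        gcongr

/-- Termwise differentiation of `∑ cₙ/n wⁿ`. -/
theorem exists_hasDerivAt_tsum_div {c : ℕ → ℝ} {ρ C : ℝ} (hρ : 0 < ρ) (h0 : c 0 = 0)
    (hc : ∀ n, |c n| * ρ ^ n ≤ C) {w : ℝ} (hw : |w| < ρ) :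
    ∃ D, HasDerivAt (fun w => ∑' n, c n / n * w ^ n) D w ∧ w * D = ∑' n, c n * w ^ n := by
  obtain ⟨r, hr1, hr2⟩ := exists_between hw
  have hr0 : 0 < r := (abs_nonneg w).trans_lt hr1
  have hu : Summable fun n => |c n| * r ^ (n - 1) := by
    have := (summable_mul_pow hρ hc (w := r) (by rwa [abs_of_pos hr0])).mul_left r⁻¹
    refine this.congr fun n => ?_
    rcases n with _ | n
    · simp [h0]
    · rw [abs_of_pos hr0, Nat.add_sub_cancel, pow_succ]
      field_simp
  have hmem : w ∈ Set.Ioo (-r) r := abs_lt.1 hr1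
  refine ⟨∑' n, c n * w ^ (n - 1), ?_, ?_⟩
  · refine hasDerivAt_tsum_of_isPreconnected (t := Set.Ioo (-r) r) (y₀ := 0)
      (g := fun n w => c n / n * w ^ n) (g' := fun n w => c n * w ^ (n - 1)) hu isOpen_Ioo
      isPreconnected_Ioo (fun n y _ => ?_) (fun n y hy => ?_) ⟨by linarith, hr0⟩ ?_ hmem
    · convert! (hasDerivAt_pow n y).const_mul (c n / n) using 1
      rcases Nat.eq_zero_or_pos n with rfl | hn
      · simp [h0]
      · have : (n : ℝ) ≠ 0 := by exact_mod_cast hn.ne'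
        field_simp
    · rw [norm_mul, norm_pow, Real.norm_eq_abs, Real.norm_eq_abs]
      have : |y| ≤ r := (abs_lt.2 hy).le
      gcongr
    · refine summable_of_ne_finset_zero (s := ∅) fun n _ => ?_
      rcases Nat.eq_zero_or_pos n with rfl | hn
      · simp
      · simp [hn.ne']
  · rw [← tsum_mul_left]
    refine tsum_congr fun n => ?_
    rcases n with _ | n
    · simp [h0]
    · rw [Nat.add_sub_cancel, pow_succ]; ring

theorem eq_of_hasDerivAt_zero_of_ne_zero {f : ℝ → ℝ} {b : ℝ} (hb : 0 < b)
    (hc : ∀ x < b, ContinuousAt f x) (hd : ∀ x < b, x ≠ 0 → HasDerivAt f 0 x) :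
    ∀ x < b, f x = f 0 := by
  intro x hx
  have hlt : ∀ y ∈ Set.uIcc 0 x, y < b := fun y hy => by
    rcases Set.mem_uIcc.1 hy with h | h <;> linarith
  have := MeasureTheory.integral_eq_of_hasDerivAt_off_countable f (fun _ => 0) (a := 0) (b := x)
    (Set.countable_singleton 0) (fun y hy => (hc y (hlt y hy)).continuousWithinAt)
    (fun y hy => hd y (hlt y (Set.Ioo_subset_Icc_self hy.1)) hy.2) (by simp)
  simp at this
  linarith

/-! ### The inverse series on the disc of radius ρ, and the zero of Ei. -/

/-- `e^{-γ}`, the radius of convergence of `∑ aₙ wⁿ`. -/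
noncomputable def rho : ℝ := Real.exp (-Real.eulerMascheroniConstant)

theorem rho_pos : 0 < rho := Real.exp_pos _

theorem exp_neg_mul_eq_rho_pow (n : ℕ) :
    Real.exp (-Real.eulerMascheroniConstant * n) = rho ^ n := by
  rw [rho, ← Real.exp_nat_mul, mul_comm]

theorem exists_abs_a_mul_rho_pow_le : ∃ C : ℝ, 0 ≤ C ∧ ∀ n : ℕ, |a n| * rho ^ n ≤ C / n := by
  simpa only [exp_neg_mul_eq_rho_pow] using exists_abs_a_le

theorem exists_abs_a_mul_rho_pow_le_const : ∃ C : ℝ, ∀ n : ℕ, |a n| * rho ^ n ≤ C := by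
  obtain ⟨C, hC, h⟩ := exists_abs_a_mul_rho_pow_le
  refine ⟨C, fun n => (h n).trans ?_⟩
  rcases Nat.eq_zero_or_pos n with rfl | hn
  · simpa using hC
  · exact div_le_self hC (by exact_mod_cast hn)

/-- The coefficient bound makes the sum analytic on the disc of radius ρ; T composed with it is the
identity near 0, hence on the whole disc. -/
theorem reT_tsum {w : ℝ} (hw : |w| < rho) : reT (∑' n, a n * w ^ n) = w := by
  obtain ⟨C, hC⟩ := exists_abs_a_mul_rho_pow_le_const
  obtain ⟨ψ, hψ, hTψ, -⟩ := exists_localInverse_T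
  set q := FormalMultilinearSeries.ofScalars ℂ (fun n => (a n : ℂ)) with hq
  have hrad : ENNReal.ofReal rho ≤ q.radius := by
    refine q.le_radius_of_bound C fun n => ?_
    rw [hq, FormalMultilinearSeries.ofScalars_norm, Complex.norm_real, Real.norm_eq_abs,
      Real.coe_toNNReal _ rho_pos.le]
    exact hC n
  have hball : HasFPowerSeriesOnBall q.sum q 0 (ENNReal.ofReal rho) :=
    (q.hasFPowerSeriesOnBall ((ENNReal.ofReal_pos.2 rho_pos).trans_le hrad)).mono
      (ENNReal.ofReal_pos.2 rho_pos) hrad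
  have han : AnalyticOnNhd ℂ q.sum (Metric.ball 0 rho) := by
    rw [← Metric.eball_ofReal]
    exact hball.analyticOnNhd
  have heq : q.sum =ᶠ[𝓝 0] ψ := by
    obtain ⟨r, hr⟩ := hψ
    filter_upwards [Metric.eball_mem_nhds (0 : ℂ) hr.r_pos,
      Metric.eball_mem_nhds (0 : ℂ) hball.r_pos] with z hz1 hz2
    have h1 := (hr.hasSum_sub hz1).unique (hball.hasSum_sub hz2)
    exact h1.symm
  have hcomp : AnalyticOnNhd ℂ (fun z => T (q.sum z)) (Metric.ball 0 rho) :=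
    fun z hz => (differentiable_T.analyticAt _).fun_comp (han z hz)
  have hid := hcomp.eqOn_of_preconnected_of_eventuallyEq (g := fun z => z)
    (fun z _ => analyticAt_id) (convex_ball 0 rho).isPreconnected
    (Metric.mem_ball_self rho_pos) (by
      filter_upwards [heq, hTψ] with z h1 h2
      rw [h1, h2])
  have hw' := hid (show (w : ℂ) ∈ Metric.ball 0 rho by simpa using hw)
  have hsum : q.sum (w : ℂ) = ((∑' n, a n * w ^ n : ℝ) : ℂ) := by
    refine (FormalMultilinearSeries.ofScalars_sum_eq (fun n => (a n : ℂ)) (w : ℂ)).trans ?_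
    rw [Complex.ofReal_tsum]
    exact tsum_congr fun n => by simp
  simp only [hsum, T_ofReal] at hw'
  exact_mod_cast hw'

theorem reT_eq_of_pos {x : ℝ} (hx : 0 < x) : reT x = rho * Real.exp (U x) := by
  rw [reT, U_ofReal, rho, ← Real.exp_add]
  nth_rewrite 1 [← Real.exp_log hx]
  rw [← Real.exp_add]
  congr 1
  ring

theorem reT_eq_of_neg {x : ℝ} (hx : x < 0) : reT x = -(rho * Real.exp (U x)) := by
  have h : x = -Real.exp (Real.log x) := by
    rw [← Real.log_neg_eq_log, Real.exp_log (by linarith)]; ring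
  rw [reT, U_ofReal, rho, ← Real.exp_add]
  nth_rewrite 1 [h]
  rw [neg_mul, ← Real.exp_add]
  congr 2
  ring

theorem tendsto_reT_atBot : Tendsto reT atBot (𝓝 (-rho)) := by
  have h : Tendsto (fun x : ℝ => -(rho * Real.exp (U x))) atBot (𝓝 (-(rho * Real.exp 0))) :=
    ((tendsto_U_ofReal.rexp).const_mul rho).neg
  rw [Real.exp_zero, mul_one] at h
  refine h.congr' ?_
  filter_upwards [eventually_lt_atBot 0] with x hx
  rw [reT_eq_of_neg hx]

theorem neg_rho_lt_reT (x : ℝ) : -rho < reT x := by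
  have h1 : -rho ≤ reT (x - 1) := le_of_tendsto tendsto_reT_atBot (by
    filter_upwards [eventually_le_atBot (x - 1)] with y hy using strictMono_reT.monotone hy)
  exact h1.trans_lt (strictMono_reT (by linarith))

theorem exists_reT_eq_rho : ∃ l : ℝ, 0 < l ∧ reT l = rho := by
  have h1 : rho ≤ reT 1 := by
    rw [reT_eq_of_pos one_pos]
    have := U_vertical_nonneg le_rfl (by positivity)
    rw [Complex.ofReal_zero, zero_mul, add_zero] at this
    exact le_mul_of_one_le_right rho_pos.le (Real.one_le_exp this)
  obtain ⟨l, hl, h⟩ := intermediate_value_Icc zero_le_one continuous_reT.continuousOn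
    (show rho ∈ Set.Icc (reT 0) (reT 1) from ⟨by rw [reT_zero]; exact rho_pos.le, h1⟩)
  refine ⟨l, hl.1.lt_of_ne ?_, h⟩
  rintro rfl
  rw [reT_zero] at h
  exact rho_pos.ne h

theorem Ei_eq_zero_iff {l : ℝ} (hl : reT l = rho) (x : ℝ) : Ei x = 0 ↔ x = l := by
  rw [Ei_eq_U]
  constructor
  · intro h
    rcases lt_trichotomy x 0 with hx | rfl | hx
    · have := reT_eq_of_neg hx
      rw [h, Real.exp_zero, mul_one] at this
      exact absurd this (neg_rho_lt_reT x).ne'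
    -- With the convention log 0 = 0 the value at 0 is γ, which is nonzero.
    · rw [U_ofReal] at h
      simp [reEin] at h
      linarith [Real.one_half_lt_eulerMascheroniConstant]
    · apply strictMono_reT.injective
      rw [hl, reT_eq_of_pos hx, h, Real.exp_zero, mul_one]
  · rintro rfl
    have hx : 0 < x := by
      rw [← strictMono_reT.lt_iff_lt, hl, reT_zero]; exact rho_pos
    rw [reT_eq_of_pos hx, mul_eq_left₀ rho_pos.ne'] at hl
    exact (Real.exp_eq_one_iff _).1 hl

/-! ### Sums along w = T(x) for x < l. -/

section

variable {l : ℝ}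

theorem abs_reT_lt (hl : reT l = rho) {x : ℝ} (hx : x < l) : |reT x| < rho :=
  abs_lt.2 ⟨neg_rho_lt_reT x, hl ▸ strictMono_reT hx⟩

theorem tsum_a_reT (hl : reT l = rho) {x : ℝ} (hx : x < l) : ∑' n, a n * reT x ^ n = x :=
  strictMono_reT.injective (reT_tsum (abs_reT_lt hl hx))

theorem pos_of_reT_eq_rho (hl : reT l = rho) : 0 < l := by
  rw [← strictMono_reT.lt_iff_lt, hl, reT_zero]; exact rho_pos

theorem tsum_zero_pow {c : ℕ → ℝ} (h0 : c 0 = 0) : ∑' n, c n * (0 : ℝ) ^ n = 0 := by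
  rw [tsum_eq_single 0 fun n hn => by simp [hn], h0, zero_mul]

/-- If `∑ cₙ wⁿ` equals `F'(x) x e^{-x}` along `w = T x`, then `∑ cₙ/n wⁿ` equals `F(x)`. -/
theorem tsum_div_reT (hl : reT l = rho) {c : ℕ → ℝ} {C : ℝ} (h0 : c 0 = 0)
    (hc : ∀ n, |c n| * rho ^ n ≤ C) {F F' : ℝ → ℝ} (hF : ∀ x, HasDerivAt F (F' x) x)
    (hF0 : F 0 = 0)
    (hcF : ∀ x < l, x ≠ 0 → ∑' n, c n * reT x ^ n = F' x * x * Real.exp (-x)) {x : ℝ}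
    (hx : x < l) : ∑' n, c n / n * reT x ^ n = F x := by
  have hd : ∀ x < l, ∃ D, HasDerivAt (fun x => ∑' n, c n / n * reT x ^ n - F x)
      (D * (Real.exp (reEin x) * Real.exp x) - F' x) x ∧
      reT x * D = ∑' n, c n * reT x ^ n := fun x hx => by
    obtain ⟨D, hD, hD'⟩ := exists_hasDerivAt_tsum_div rho_pos h0 hc (abs_reT_lt hl hx)
    exact ⟨D, (hD.comp x (hasDerivAt_reT x)).sub (hF x), hD'⟩
  -- At x = 0 the factor `reT x` vanishes and `hD'` says nothing about D; continuity bridges that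
  -- point.
  have := eq_of_hasDerivAt_zero_of_ne_zero (f := fun x => ∑' n, c n / n * reT x ^ n - F x)
    (pos_of_reT_eq_rho hl)
    (fun x hx => (hd x hx).choose_spec.1.continuousAt) (fun x hx hx0 => by
      obtain ⟨D, hD, hD'⟩ := hd x hx
      convert! hD using 1
      rw [hcF x hx hx0, reT, Real.exp_neg] at hD'
      have he := (Real.exp_pos x).ne'
      have : Real.exp (reEin x) * D * Real.exp x = F' x := by
        field_simp at hD'
        linarith
      linarith) x hx
  have hz : ∑' n, c n / n * (0 : ℝ) ^ n = 0 := tsum_zero_pow (c := fun n => c n / n) (by simp)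
  simp only [reT_zero, hz, hF0, sub_zero] at this
  linarith

theorem tsum_a_div_reT (hl : reT l = rho) {x : ℝ} (hx : x < l) :
    ∑' n, a n / n * reT x ^ n = Real.exp x - 1 := by
  obtain ⟨C, hC⟩ := exists_abs_a_mul_rho_pow_le_const
  refine tsum_div_reT hl a_zero hC (F := fun x => Real.exp x - 1) (F' := Real.exp)
    (fun x => (Real.hasDerivAt_exp x).sub_const 1) (by simp) (fun x hx _ => ?_) hx
  rw [tsum_a_reT hl hx, Real.exp_neg]
  field_simp

theorem abs_div_nat_le (x : ℝ) (n : ℕ) : |x / n| ≤ |x| := by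
  rcases Nat.eq_zero_or_pos n with rfl | hn
  · simp
  · rw [abs_div, Nat.abs_cast]
    exact div_le_self (abs_nonneg x) (by exact_mod_cast hn)

/-- (eˣ - 1) eˣ/x = (e^{2x} - 1)/x - (eˣ - 1)/x, and the right side is the derivative of Ein(2x) -
Ein(x). -/
theorem tsum_a_div_sq_reT (hl : reT l = rho) {x : ℝ} (hx : x < l) :
    ∑' n, a n / n / n * reT x ^ n = reEin (2 * x) - reEin x := by
  obtain ⟨C, hC⟩ := exists_abs_a_mul_rho_pow_le_const
  refine tsum_div_reT hl (c := fun n => a n / n) (C := C) (by simp) (fun n => ?_)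
    (F := fun x => reEin (2 * x) - reEin x)
    (F' := fun x => (expSlope (2 * x : ℝ)).re * 2 - (expSlope x).re)
    (fun x => ?_) (by simp [reEin]) (fun x hx hx0 => ?_) hx
  · exact (mul_le_mul_of_nonneg_right (abs_div_nat_le _ n) (pow_pos rho_pos n).le).trans (hC n)
  · have h2 : HasDerivAt (fun x : ℝ => 2 * x) 2 x := by
      simpa using (hasDerivAt_id x).const_mul (2 : ℝ)
    exact ((hasDerivAt_reEin (2 * x)).comp x h2).sub (hasDerivAt_reEin x)
  · rw [tsum_a_div_reT hl hx, expSlope_ofReal_re hx0, expSlope_ofReal_re (by positivity),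
      two_mul, Real.exp_add, Real.exp_neg]
    have := (Real.exp_pos x).ne'
    field_simp
    ring

end

/-! ### Passage to the boundary points w = ±ρ. -/

theorem partialSum_eq_sum_range {u : ℕ → ℝ} (h0 : u 0 = 0) (N : ℕ) :
    partialSum u N = ∑ n ∈ Finset.range (N + 1), u n := by
  rw [partialSum, Finset.range_eq_Ico, Finset.sum_eq_sum_Ico_succ_bot (Nat.succ_pos N), h0,
    zero_add, zero_add]
  rfl

theorem seriesTo_iff {u : ℕ → ℝ} (h0 : u 0 = 0) (L : ℝ) :
    SeriesTo u L ↔ Tendsto (fun N => ∑ n ∈ Finset.range N, u n) atTop (𝓝 L) := by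
  rw [SeriesTo, ← tendsto_add_atTop_iff_nat 1 (f := fun N => ∑ n ∈ Finset.range N, u n)]
  exact tendsto_congr (partialSum_eq_sum_range h0)

theorem continuousOn_tsum_pow {c : ℕ → ℝ} (hc : Summable fun n => |c n| * rho ^ n) :
    ContinuousOn (fun w => ∑' n, c n * w ^ n) (Set.Icc (-rho) rho) := by
  refine continuousOn_tsum (fun n => by fun_prop) hc fun n w hw => ?_
  rw [norm_mul, norm_pow, Real.norm_eq_abs, Real.norm_eq_abs]
  have := abs_le.2 hw
  gcongr

theorem summable_a_div : Summable fun n => |a n / n| * rho ^ n := by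
  obtain ⟨C, hC, h⟩ := exists_abs_a_mul_rho_pow_le
  refine Summable.of_nonneg_of_le (fun n => mul_nonneg (abs_nonneg _) (pow_pos rho_pos n).le)
    (fun n => ?_) ((Real.summable_one_div_nat_pow.2 one_lt_two).mul_left C)
  rw [abs_div, Nat.abs_cast, div_mul_eq_mul_div]
  calc |a n| * rho ^ n / n ≤ C / n / n := by
        have := h n
        gcongr
    _ = C * (1 / (n : ℝ) ^ 2) := by ring

theorem summable_a_div_sq : Summable fun n => |a n / n / n| * rho ^ n :=
  Summable.of_nonneg_of_le (fun n => mul_nonneg (abs_nonneg _) (pow_pos rho_pos n).le)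
    (fun n => mul_le_mul_of_nonneg_right (abs_div_nat_le _ n) (pow_pos rho_pos n).le)
    summable_a_div

section

variable {l : ℝ} {c : ℕ → ℝ} {F : ℝ → ℝ} {L : ℝ}

/-- Absolute convergence at ρ gives continuity of the sum on [-ρ, ρ], and T(x) → ρ as x increases to
l. -/
theorem hasSum_rho (hl : reT l = rho) (hc : Summable fun n => |c n| * rho ^ n)
    (hF : ∀ x < l, ∑' n, c n * reT x ^ n = F x) (hlim : Tendsto F (𝓝[<] l) (𝓝 L)) :
    HasSum (fun n => c n * rho ^ n) L := by
  have hs : Summable fun n => c n * rho ^ n := by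
    refine Summable.of_norm (hc.congr fun n => ?_)
    rw [norm_mul, Real.norm_eq_abs, Real.norm_of_nonneg (pow_pos rho_pos n).le]
  have h1 := continuousOn_tsum_pow hc rho ⟨by linarith [rho_pos], le_rfl⟩
  have h2 : Tendsto reT (𝓝[<] l) (𝓝[Set.Icc (-rho) rho] rho) := by
    refine tendsto_nhdsWithin_iff.2 ⟨?_, ?_⟩
    · rw [← hl]; exact continuous_reT.continuousAt.tendsto.mono_left nhdsWithin_le_nhds
    · filter_upwards [self_mem_nhdsWithin] with x hx
      exact Set.Ioo_subset_Icc_self (abs_lt.1 (abs_reT_lt hl hx))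
  have h3 : Tendsto F (𝓝[<] l) (𝓝 (∑' n, c n * rho ^ n)) := by
    refine (h1.tendsto.comp h2).congr' ?_
    filter_upwards [self_mem_nhdsWithin] with x hx using hF x hx
  rw [← tendsto_nhds_unique h3 hlim]
  exact hs.hasSum

theorem hasSum_neg_rho (hl : reT l = rho) (hc : Summable fun n => |c n| * rho ^ n)
    (hF : ∀ x < l, ∑' n, c n * reT x ^ n = F x) (hlim : Tendsto F atBot (𝓝 L)) :
    HasSum (fun n => c n * (-rho) ^ n) L := by
  have hs : Summable fun n => c n * (-rho) ^ n := by
    refine Summable.of_norm (hc.congr fun n => ?_)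
    rw [norm_mul, Real.norm_eq_abs, norm_pow, norm_neg, Real.norm_of_nonneg rho_pos.le]
  have h1 := continuousOn_tsum_pow hc (-rho) ⟨le_rfl, by linarith [rho_pos]⟩
  have h2 : Tendsto reT atBot (𝓝[Set.Icc (-rho) rho] (-rho)) := by
    refine tendsto_nhdsWithin_iff.2 ⟨tendsto_reT_atBot, ?_⟩
    filter_upwards [eventually_lt_atBot l] with x hx
    exact Set.Ioo_subset_Icc_self (abs_lt.1 (abs_reT_lt hl hx))
  have h3 : Tendsto F atBot (𝓝 (∑' n, c n * (-rho) ^ n)) := by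
    refine (h1.tendsto.comp h2).congr' ?_
    filter_upwards [eventually_lt_atBot l] with x hx using hF x hx
  rw [← tendsto_nhds_unique h3 hlim]
  exact hs.hasSum

theorem seriesTo_a_div (hl : reT l = rho) :
    SeriesTo (fun n => a n / n * Real.exp (-Real.eulerMascheroniConstant * n))
      (Real.exp l - 1) := by
  simp only [exp_neg_mul_eq_rho_pow]
  refine (seriesTo_iff (by simp) _).2 (hasSum_rho hl summable_a_div
    (F := fun x => Real.exp x - 1) (fun x hx => tsum_a_div_reT hl hx) ?_).tendsto_sum_nat
  exact (Real.continuous_exp.sub continuous_const).continuousAt.tendsto.mono_left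
    nhdsWithin_le_nhds

theorem neg_one_pow_pred_mul (x : ℝ) {n : ℕ} (hn : n ≠ 0) :
    (-1) ^ (n - 1) * x = -(x * (-1) ^ n) := by
  obtain ⟨m, rfl⟩ := Nat.exists_eq_succ_of_ne_zero hn
  rw [Nat.succ_eq_add_one, Nat.add_sub_cancel, pow_succ]
  ring

theorem seriesTo_alternating_a_div :
    SeriesTo (fun n => (-1) ^ (n - 1) * a n / n *
      Real.exp (-Real.eulerMascheroniConstant * n)) 1 := by
  obtain ⟨l, -, hl⟩ := exists_reT_eq_rho
  simp only [exp_neg_mul_eq_rho_pow]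
  have h := hasSum_neg_rho hl summable_a_div (F := fun x => Real.exp x - 1) (L := -1)
    (fun x hx => tsum_a_div_reT hl hx) (by simpa using Real.tendsto_exp_atBot.sub_const 1)
  refine (seriesTo_iff (by simp) _).2 (HasSum.tendsto_sum_nat ?_)
  convert! h.neg using 1
  · funext n
    rcases eq_or_ne n 0 with rfl | hn
    · simp
    · rw [neg_one_pow_pred_mul _ hn, neg_pow rho]
      ring
  · ring

theorem seriesTo_alternating_a_div_sq :
    SeriesTo (fun n => (-1) ^ (n - 1) * a n / n ^ 2 *
      Real.exp (-Real.eulerMascheroniConstant * n)) (Real.log 2) := by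
  obtain ⟨l, -, hl⟩ := exists_reT_eq_rho
  simp only [exp_neg_mul_eq_rho_pow]
  have hlim : Tendsto (fun x => reEin (2 * x) - reEin x) atBot (𝓝 (-Real.log 2)) := by
    -- The limits of Ein(2x) + ln|2x| and Ein x + ln|x| coincide, so only -ln 2 remains.
    have h1 := (tendsto_reEin_add_log.comp
      (tendsto_id.const_mul_atBot (two_pos : (0 : ℝ) < 2))).sub tendsto_reEin_add_log
    have h2 := h1.sub_const (Real.log 2)
    rw [sub_self, zero_sub] at h2
    refine h2.congr' ?_
    filter_upwards [eventually_lt_atBot 0] with x hx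
    simp only [Function.comp, id]
    rw [Real.log_mul two_ne_zero hx.ne]
    ring
  have h := hasSum_neg_rho hl summable_a_div_sq (fun x hx => tsum_a_div_sq_reT hl hx) hlim
  refine (seriesTo_iff (by simp) _).2 (HasSum.tendsto_sum_nat ?_)
  convert! h.neg using 1
  · funext n
    rcases eq_or_ne n 0 with rfl | hn
    · simp
    · rw [neg_one_pow_pred_mul _ hn, neg_pow rho]
      ring
  · ring

/-- Abel's limit theorem, applied along r = T(x)/ρ as x increases to l, where the Abel sum is x
itself. -/
theorem eq_of_seriesTo_a (hl : reT l = rho)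
    (h : SeriesTo (fun n => a n * Real.exp (-Real.eulerMascheroniConstant * n)) L) : L = l := by
  simp only [exp_neg_mul_eq_rho_pow] at h
  have h1 := Real.tendsto_tsum_powerSeries_nhdsWithin_lt
    ((seriesTo_iff (by simp [a_zero]) _).1 h)
  have h2 : Tendsto (fun x => reT x / rho) (𝓝[<] l) (𝓝[<] 1) := by
    refine tendsto_nhdsWithin_iff.2 ⟨?_, ?_⟩
    · have : Tendsto (fun x => reT x / rho) (𝓝 l) (𝓝 (reT l / rho)) :=
        (continuous_reT.div_const rho).continuousAt
      rw [hl, div_self rho_pos.ne'] at this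
      exact this.mono_left nhdsWithin_le_nhds
    · filter_upwards [self_mem_nhdsWithin] with x hx
      exact (div_lt_one rho_pos).2 (abs_lt.1 (abs_reT_lt hl hx)).2
  have h3 : Tendsto (fun x : ℝ => x) (𝓝[<] l) (𝓝 L) := by
    refine (h1.comp h2).congr' ?_
    filter_upwards [self_mem_nhdsWithin] with x hx
    refine (tsum_congr fun n => ?_).trans (tsum_a_reT hl hx)
    have := rho_pos.ne'
    rw [div_pow]
    field_simp
  exact tendsto_nhds_unique h3 (tendsto_id.mono_left nhdsWithin_le_nhds)

end

/-! ### Divergence of the alternating series. -/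

theorem tendsto_partialSum_alternating_a :
    Tendsto (partialSum (fun n => (-1) ^ (n - 1) * a n *
      Real.exp (-Real.eulerMascheroniConstant * n))) atTop atTop := by
  simp only [exp_neg_mul_eq_rho_pow]
  set b : ℕ → ℝ := fun n => (-1) ^ (n - 1) * a n * rho ^ n with hb
  have hb0 : b 0 = 0 := by simp [hb, a_zero]
  obtain ⟨C, hC, hbC⟩ := exists_abs_a_mul_rho_pow_le
  have hbound : ∀ n, |b n| ≤ C / n := fun n => by
    rw [hb, abs_mul, abs_mul, abs_pow, abs_neg, abs_one, one_pow, one_mul,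
      abs_of_pos (pow_pos rho_pos n)]
    exact hbC n
  have htsum : ∀ r : ℝ, ∑' n, b n * r ^ n = -∑' n, a n * (-(rho * r)) ^ n := fun r => by
    rw [← tsum_neg]
    refine tsum_congr fun n => ?_
    rcases eq_or_ne n 0 with rfl | hn
    · simp [hb0, a_zero]
    · simp only [hb]
      rw [neg_one_pow_pred_mul _ hn, neg_pow (rho * r), mul_pow]
      ring
  have hr : Tendsto (fun N : ℕ => 1 - 1 / ((N : ℝ) + 1)) atTop (𝓝 1) := by
    simpa using (tendsto_one_div_add_atTop_nhds_zero_nat (𝕜 := ℝ)).const_sub 1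
  refine tendsto_atTop.2 fun M => ?_
  -- By monotonicity of T the Abel mean then exceeds M + 2C, and 2C covers its distance from the
  -- partial sum.
  have hev : ∀ᶠ N : ℕ in atTop, -(rho * (1 - 1 / ((N : ℝ) + 1))) < reT (-(M + 2 * C)) := by
    have h1 := (hr.const_mul rho).neg
    rw [mul_one] at h1
    exact h1.eventually_lt_const (neg_rho_lt_reT _)
  filter_upwards [hev] with N hN
  have hpos : (0 : ℝ) < 1 / ((N : ℝ) + 1) := by positivity
  have hle : 1 / ((N : ℝ) + 1) ≤ 1 := by
    rw [div_le_one (by positivity)]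
    linarith [(Nat.cast_nonneg N : (0 : ℝ) ≤ N)]
  have habs : |-(rho * (1 - 1 / ((N : ℝ) + 1)))| < rho := by
    rw [abs_neg, abs_of_nonneg (mul_nonneg rho_pos.le (by linarith))]
    nlinarith [rho_pos]
  have h1 := reT_tsum habs
  rw [← h1, strictMono_reT.lt_iff_lt] at hN
  have h2 := (abs_le.1 (abs_tsum_pow_sub_sum_le hC hbound N)).2
  rw [htsum] at h2
  rw [partialSum_eq_sum_range hb0]
  linarith

end RamanujanSoldner

open RamanujanSoldner in
theorem theorem2p1 :
    -- the numbers `aₙ` are real, and both residue formulas for them hold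
    (∀ n : ℕ, 1 ≤ n →
      1 / (n : ℂ) * RamanujanSoldner.residue (fun z =>
          Complex.exp (-(n : ℂ) *
            (RamanujanSoldner.cEi z - (Real.eulerMascheroniConstant : ℂ)))) 0
        = (RamanujanSoldner.a n : ℂ) ∧
      1 / (n : ℂ) * RamanujanSoldner.residue (fun z =>
          Complex.exp (-(n : ℂ) * RamanujanSoldner.ein z) / z ^ n) 0
        = (RamanujanSoldner.a n : ℂ)) ∧
    -- they are the Taylor coefficients at `0` of the local inverse `ψ` of `T`
    (∃ ψ : ℂ → ℂ,
      HasFPowerSeriesAt ψ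
        (FormalMultilinearSeries.ofScalars ℂ (fun n => (RamanujanSoldner.a n : ℂ))) 0 ∧
      (∀ᶠ z in 𝓝 (0 : ℂ), RamanujanSoldner.T (ψ z) = z) ∧
      (∀ᶠ z in 𝓝 (0 : ℂ), ψ (RamanujanSoldner.T z) = z)) ∧
    -- the Ramanujan-Soldner constant exists and is unique
    (∃! μ : ℝ, 0 < μ ∧ RamanujanSoldner.Ei (Real.log μ) = 0) ∧
    -- the series
    (∀ μ : ℝ, 0 < μ → RamanujanSoldner.Ei (Real.log μ) = 0 →
      (∀ L : ℝ,
        RamanujanSoldner.SeriesTo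
          (fun n => RamanujanSoldner.a n * Real.exp (-Real.eulerMascheroniConstant * n)) L →
        L = Real.log μ) ∧
      RamanujanSoldner.SeriesTo
        (fun n => RamanujanSoldner.a n / n * Real.exp (-Real.eulerMascheroniConstant * n))
        (μ - 1)) ∧
    Tendsto (RamanujanSoldner.partialSum (fun n =>
        (-1) ^ (n - 1) * RamanujanSoldner.a n * Real.exp (-Real.eulerMascheroniConstant * n)))
      atTop atTop ∧
    RamanujanSoldner.SeriesTo (fun n =>
        (-1) ^ (n - 1) * RamanujanSoldner.a n / n *
          Real.exp (-Real.eulerMascheroniConstant * n)) 1 ∧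
    RamanujanSoldner.SeriesTo (fun n =>
        (-1) ^ (n - 1) * RamanujanSoldner.a n / n ^ 2 *
          Real.exp (-Real.eulerMascheroniConstant * n)) (Real.log 2) := by
  
  obtain ⟨l, hl0, hl⟩ := exists_reT_eq_rho
  have hEi : ∀ μ : ℝ, Ei (Real.log μ) = 0 → Real.log μ = l := fun μ h =>
    (Ei_eq_zero_iff hl _).1 h
  refine ⟨fun n _ => ⟨?_, ?_⟩, exists_localInverse_T, ⟨Real.exp l, ⟨Real.exp_pos l, ?_⟩, ?_⟩,
    fun μ hμ h => ⟨fun L hL => ?_, ?_⟩, tendsto_partialSum_alternating_a,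
    seriesTo_alternating_a_div, seriesTo_alternating_a_div_sq⟩
  · rw [a, aComplex_eq, Complex.ofReal_re, ← aComplex_eq, aComplex]
  · rw [residue_ein, a_eq]
    push_cast
    ring
  · rw [Real.log_exp]
    exact (Ei_eq_zero_iff hl l).2 rfl
  · rintro μ ⟨hμ, h⟩
    rw [← hEi μ h, Real.exp_log hμ]
  · rw [hEi μ h]
    exact eq_of_seriesTo_a hl hL
  · have := seriesTo_a_div hl
    rwa [← hEi μ h, Real.exp_log hμ] at this
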